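/- Let $b$ be a prime, $m,s\in\mathbb{N}_0$, $N=b^m$, let $0\le w_1\le\dots\le w_s$ be integers (the reduction indices) and let $\gamma=(\gamma_{\mathfrak u})_{\mathfrak u\subseteq\{1,\dots,s\}}$ be arbitrary nonnegative weights. **Sobolev space.** $\mathcal W_{s,\gamma}$ is the weighted unanchored Sobolev space of functions $F$ on $[-\frac12,\frac12]^s$ which are square integrable together with all weak mixed first derivatives $\partial^{|\mathfrak u|}F/\partial y_{\mathfrak u}$, $\mathfrak u\subseteq\{1,\dots,s\}$, and for which the norm $$\|F\|_{\mathcal W_{s,\gamma}}=\Bigl(\sum_{\mathfrak u\subseteq\{1,\dots,s\}}\gamma_{\mathfrak u}^{-1}\int_{[-\frac12,\frac12]^{|\mathfrak u|}}\Bigl(\int_{[-\frac12,\frac12]^{s-|\mathfrak u|}}\frac{\partial^{|\mathfrak u|}F}{\partial y_{\mathfrak u}}(y_{\mathfrak u};y_{-\mathfrak u})\,dy_{-\mathfrak u}\Bigr)^2dy_{\mathfrak u}\Bigr)^{1/2}$$ is finite (with $1/0=\infty$, $\infty\cdot 0=0$). **Randomly shifted lattice rule.** For a generating vector $z\in\mathbb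 Z^s$ and a shift $\Delta$ uniformly distributed in $[0,1]^s$, $Q_N(F)=\frac1N\sum_{k=1}^N F\bigl(\{kz/N+\Delta\}-(\frac12,\dots,\frac12)\bigr)$, where $\{\cdot\}$ is the componentwise fractional part, and $I_s(F)=\int_{[-\frac12,\frac12]^s}F(y)\,dy$. **Korobov error.** For $d\le s$ and $z\in\mathbb Z^d$, let $e_{N,d}(z)$ be the worst-case error $\sup_f\bigl|\int_{[0,1]^d}f(x)\,dx-\frac1N\sum_{k=1}^N f(kz/N)\bigr|$ over all continuous $1$-periodic $f:\mathbb R^d\to\mathbb C$ with $\sum_{h\in\mathbb Z^d}\widetilde\gamma_{\mathfrak u(h)}^{-1}\prod_{j\in\mathfrak u(h)}|h_j|^2\,|\widehat f(h)|^2\le1$, where $\mathfrak u(h)=\{j:h_j\ne0\}$ and $\widetilde\gamma_{\mathfrak u}=\gamma_{\mathfrak u}/(2\pi^2)^{|\mathfrak u|}$; this is the unit ball of the Korobov space of smoothness $2$ with weights $\widetilde\gamma$. **Reduced CBC algorithm.** For $j=1,\dots,s$ with $w_j<m$ successively choose $z_j\in\{z\in\{0,\dots,b^{m-w_j}-1\}:\gcd(z,b^{m-w_j})=1\}$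 minimizing $z\mapsto e_{N,j}^2(b^{w_1}z_1,\dots,b^{w_{j-1}}z_{j-1},b^{w_j}z)$ over this set; for $w_j\ge m$ put $z_j=0$. The output is $\widetilde z=(b^{w_1}z_1,\dots,b^{w_s}z_s)$. **Theorem.** The algorithm has an output, and every possible output $\widetilde z$ (for any choice among several minimizers) has the following property. For all $F\in\mathcal W_{s,\gamma}$ the lattice rule with generating vector $\widetilde z$ satisfies, for all $\lambda\in(1/2,1]$, $$\sqrt{\mathbb E_{\Delta}\bigl[|I_s(F)-Q_N(F)|^2\bigr]}\le\Bigl(\sum_{\emptyset\ne\mathfrak u\subseteq\{1,\dots,s\}}\gamma_{\mathfrak u}^{\lambda}\,\varrho(\lambda)^{|\mathfrak u|}\,b^{\min\{m,\max_{j\in\mathfrak u}w_j\}}\Bigr)^{1/(2\lambda)}\Bigl(\frac2N\Bigr)^{1/(2\lambda)}\|F\|_{\mathcal W_{s,\gamma}},$$ where $\varrho(\lambda)=2\zeta(2\lambda)(2\pi^2)^{-\lambda}$, and the expectation on the left exists and is finite. -/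

import Mathlib

open MeasureTheory
open scoped ENNReal ContDiff

noncomputable section

namespace ReducedCBC

/-! ### The cube `[-1/2, 1/2]^ι` -/

/-- The closed cube `[-1/2, 1/2]^ι`. -/
def cube (ι : Type*) : Set (ι → ℝ) := Set.Icc (fun _ => -(1 / 2)) (fun _ => 1 / 2)

/-- The open cube `(-1/2, 1/2)^ι`. -/
def openCube (ι : Type*) : Set (ι → ℝ) := Set.univ.pi fun _ => Set.Ioo (-(1 / 2)) (1 / 2)

/-- Lebesgue measure on the closed cube. -/
def cubeMeasure (ι : Type*) [Fintype ι] : Measure (ι → ℝ) := volume.restrict (cube ι)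

/-! ### The weighted unanchored Sobolev space -/

/-- The classical mixed first partial derivative `∂^{|u|} φ / ∂ y_u`: one differentiation in each
of the coordinates in `u`. -/
def mixedPartial {s : ℕ} (u : Finset (Fin s)) (φ : (Fin s → ℝ) → ℝ) : (Fin s → ℝ) → ℝ :=
  (u.sort (· ≤ ·)).foldr (fun j g y => lineDeriv ℝ g y (Pi.single j 1)) φ

/-- `g` is square integrable on the cube and is a weak mixed first derivative of `F` with respect
to the variables in `u`. -/
def IsWeakMixedDeriv {s : ℕ} (F : (Fin s → ℝ) → ℝ) (u : Finset (Fin s))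
    (g : (Fin s → ℝ) → ℝ) : Prop :=
  MemLp g 2 (cubeMeasure (Fin s)) ∧
    ∀ φ : (Fin s → ℝ) → ℝ, ContDiff ℝ ∞ φ → HasCompactSupport φ →
      tsupport φ ⊆ openCube (Fin s) →
      ∫ y, F y * mixedPartial u φ y ∂(cubeMeasure (Fin s)) =
        (-1) ^ u.card * ∫ y, g y * φ y ∂(cubeMeasure (Fin s))

open Classical in
/-- The weak mixed derivative of `F` with respect to the variables in `u` (unique almost everywhere
on the cube; zero if there is none). -/
def weakMixedDeriv {s : ℕ} (F : (Fin s → ℝ) → ℝ) (u : Finset (Fin s)) : (Fin s → ℝ) → ℝ :=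
  if h : ∃ g, IsWeakMixedDeriv F u g then h.choose else 0

/-- The point `(y_u; y_{-u})` with the given coordinates in `u` and outside `u`. -/
def combine {s : ℕ} (u : Finset (Fin s)) (yu : {j // j ∈ u} → ℝ) (yc : {j // j ∉ u} → ℝ) :
    Fin s → ℝ :=
  fun j => if h : j ∈ u then yu ⟨j, h⟩ else yc ⟨j, h⟩

/-- The norm of the weighted unanchored Sobolev space, with values in `[0, ∞]`. For a zero weight
the usual conventions `1 / 0 = ∞` and `∞ * 0 = 0` apply. -/
def sobolevNorm {s : ℕ} (γ : Finset (Fin s) → ℝ) (F : (Fin s → ℝ) → ℝ) : ℝ≥0∞ :=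
  (∑ u : Finset (Fin s), (ENNReal.ofReal (γ u))⁻¹ *
    ∫⁻ yu, ‖∫ yc, weakMixedDeriv F u (combine u yu yc) ∂(cubeMeasure {j // j ∉ u})‖ₑ ^ 2
      ∂(cubeMeasure {j // j ∈ u})) ^ (1 / 2 : ℝ)

/-- Membership in the weighted unanchored Sobolev space: `F` and all its weak mixed first
derivatives are square integrable, and the norm is finite. -/
def MemSobolev {s : ℕ} (γ : Finset (Fin s) → ℝ) (F : (Fin s → ℝ) → ℝ) : Prop :=
  MemLp F 2 (cubeMeasure (Fin s)) ∧ (∀ u, ∃ g, IsWeakMixedDeriv F u g) ∧ sobolevNorm γ F < ⊤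

/-! ### Randomly shifted lattice rules -/

/-- The integral of `F` over the cube. -/
def cubeIntegral {s : ℕ} (F : (Fin s → ℝ) → ℝ) : ℝ := ∫ y, F y ∂(cubeMeasure (Fin s))

/-- The `N`-point rank-1 lattice rule on the cube with generating vector `z` and shift `Δ`. -/
def shiftedLatticeRule {s : ℕ} (N : ℕ) (z : Fin s → ℕ) (Δ : Fin s → ℝ) (F : (Fin s → ℝ) → ℝ) : ℝ :=
  (1 / (N : ℝ)) * ∑ k ∈ Finset.Icc 1 N,
    F (fun j => Int.fract ((k : ℝ) * (z j : ℝ) / (N : ℝ) + Δ j) - 1 / 2)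

/-- The squared integration error as a function of the shift. -/
def sqError {s : ℕ} (N : ℕ) (z : Fin s → ℕ) (F : (Fin s → ℝ) → ℝ) (Δ : Fin s → ℝ) : ℝ :=
  |cubeIntegral F - shiftedLatticeRule N z Δ F| ^ 2

/-- The root-mean-square error over a uniformly distributed shift in `[0, 1]^s`. -/
def rmse {s : ℕ} (N : ℕ) (z : Fin s → ℕ) (F : (Fin s → ℝ) → ℝ) : ℝ :=
  Real.sqrt (∫ Δ in Set.Icc (0 : Fin s → ℝ) 1, sqError N z F Δ)

/-! ### Lattice rules in the weighted Korobov space -/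

/-- The set of coordinates at which the frequency vector `h` does not vanish. -/
def freqSupport {d : ℕ} (h : Fin d → ℤ) : Finset (Fin d) := Finset.univ.filter fun j => h j ≠ 0

/-- The squared norm of the weighted Korobov space of smoothness `α`, with values in `[0, ∞]`
(conventions `1 / 0 = ∞` and `∞ * 0 = 0`). For `α > 1` the space consists of the continuous
1-periodic functions for which it is finite. -/
def korobovNormSq {d : ℕ} (α : ℝ) (γ : Finset (Fin d) → ℝ) (f : C(UnitAddTorus (Fin d), ℂ)) :
    ℝ≥0∞ :=
  ∑' h : Fin d → ℤ, (ENNReal.ofReal (γ (freqSupport h)))⁻¹ *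
    (∏ j ∈ freqSupport h, ENNReal.ofReal (|(h j : ℝ)| ^ α)) *
      ‖UnitAddTorus.mFourierCoeff f h‖ₑ ^ 2

/-- The integral of a periodic function over `[0, 1]^d`. -/
def periodIntegral {d : ℕ} (f : C(UnitAddTorus (Fin d), ℂ)) : ℂ :=
  ∫ x in Set.Icc (0 : Fin d → ℝ) 1, f (fun j => (x j : UnitAddCircle))

/-- The `N`-point rank-1 lattice rule with generating vector `z` for periodic functions. -/
def latticeRule {d : ℕ} (N : ℕ) (z : Fin d → ℕ) (f : C(UnitAddTorus (Fin d), ℂ)) : ℂ :=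
  (1 / (N : ℂ)) * ∑ k ∈ Finset.Icc 1 N,
    f (fun j => (((k : ℝ) * (z j : ℝ) / (N : ℝ) : ℝ) : UnitAddCircle))

/-- The worst-case error of the lattice rule over the unit ball of the Korobov space. -/
def korobovError {d : ℕ} (α : ℝ) (γ : Finset (Fin d) → ℝ) (N : ℕ) (z : Fin d → ℕ) : ℝ≥0∞ :=
  ⨆ (f : C(UnitAddTorus (Fin d), ℂ)) (_ : korobovNormSq α γ f ≤ 1),
    ‖periodIntegral f - latticeRule N z f‖ₑ

/-! ### The reduced component-by-component construction -/

/-- The units modulo `n`, as residues in `{0, …, n - 1}`; this is `{0}` for `n = 1`. -/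
def unitsMod (n : ℕ) : Finset ℕ := (Finset.range n).filter fun z => Nat.Coprime z n

/-- The generating vector `(b^{w_1} z_1, …, b^{w_s} z_s)`. -/
def genVector {s : ℕ} (b : ℕ) (w : Fin s → ℕ) (z : Fin s → ℕ) : Fin s → ℕ :=
  fun j => b ^ w j * z j

/-- The squared worst-case error of the lattice rule formed by the first components of `z`, up to
and including the component `j`, in the Korobov space over these coordinates. -/
def prefixErrorSq {s : ℕ} (α : ℝ) (γ : Finset (Fin s) → ℝ) (N : ℕ) (z : Fin s → ℕ) (j : Fin s) :
    ℝ≥0∞ :=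
  korobovError (d := j.val + 1) α
    (fun u => γ (u.map (Fin.castLEEmb j.isLt))) N (fun i => z (Fin.castLE j.isLt i)) ^ 2

/-- `(z_1, …, z_s)` is a possible outcome of the reduced CBC construction with `N = b^m` points,
reduction indices `w`, and Korobov worst-case error of smoothness `α` and weights `γ`:
components with `w_j < m` are successively selected among the units modulo `b^{m - w_j}` so as to
minimize the squared worst-case error, with arbitrary selection among several minimizers; the
remaining components are zero. -/
structure IsOutcome {s : ℕ} (b m : ℕ) (w : Fin s → ℕ) (α : ℝ) (γ : Finset (Fin s) → ℝ)
    (z : Fin s → ℕ) : Prop where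
  eq_zero : ∀ j, m ≤ w j → z j = 0
  mem_units : ∀ j, w j < m → z j ∈ unitsMod (b ^ (m - w j))
  minimal : ∀ j, w j < m → ∀ x ∈ unitsMod (b ^ (m - w j)),
    prefixErrorSq α γ (b ^ m) (genVector b w z) j ≤
      prefixErrorSq α γ (b ^ m) (genVector b w (Function.update z j x)) j

/-- The weights `γ_u / (2π²)^{|u|}` of the Korobov space (of smoothness 2) whose kernel is the
shift-averaged kernel of the unanchored Sobolev space with weights `γ_u`. -/
def korobovWeights {s : ℕ} (γ : Finset (Fin s) → ℝ) (u : Finset (Fin s)) : ℝ :=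
  γ u / (2 * Real.pi ^ 2) ^ u.card

/-- The constant `ϱ(λ) = 2 ζ(2λ) (2π²)^{-λ}`. -/
def rho (lam : ℝ) : ℝ :=
  2 * (riemannZeta ((2 * lam : ℝ) : ℂ)).re * (2 * Real.pi ^ 2) ^ (-lam)

end ReducedCBC

end

noncomputable section

namespace ReducedCBC

/-! ### Solutions of linear congruences -/

/-! The argument runs through the Fourier coefficients on the dual lattice, the frequencies `h` with
`N ∣ h · z`.

From the error to a dual sum. On the torus, averaging over the lattice points multiplies the
coefficient at `h` by 1 on the dual lattice and by 0 off it; subtracting the integral removes `h =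
0`. By Parseval the mean square error is the sum of `|F̂(h)|²` over the nonzero dual `h`
(`integral_sqError`). If `h` has support `u`, integrate by parts once in each variable of `u`, using
the antiderivative of the exponential that vanishes at both end points: no boundary terms arise
although `F` is not periodic. Cauchy-Schwarz bounds `|F̂(h)|²` by the product of `1 / (2π² h_j²)`
over `u` times the `u`-part of the Sobolev norm (`enorm_cubeFourierCoeff_sq_le`), which is at most
`γ_u ‖F‖²`. So the mean square error is at most `S ‖F‖²`, where `S` sums `γ̃_u ∏ h_j⁻²` over the
nonzero dual lattice. This `S` is also the squared Korobov worst-case error (`korobovError_sq`), the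
quantity that the algorithm minimizes.

Bounding `S`. Group the frequencies by their last nonzero component `d`. Step `d` leaves the earlier
groups alone, so a minimizing `z_d` minimizes group `d`, whose `λ`-th power is then at most its
average over the units modulo `M = b^(m - w_d)`. Jensen's inequality moves `λ` inside the sum. With
the other frequencies fixed, the dual condition is unsolvable or reads `M ∣ a + k x`. Put `g =
gcd(a, M)`: only `k = g q` admits unit solutions, at most `g` of them, and `g |g q|^(-2λ) ≤
|q|^(-2λ)`. The sum over all units thus costs only `2ζ(2λ)` per component (`sum_units_freqTerm_le`,
`sum_units_freqProd_le`), and division by `φ(M) ≥ M / 2` yields `2 b^(w_d) / N`. As `w` is monotone,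
`w_d` is the maximum of `w` over the sets ending in `d`. -/

lemma card_linear_congruence_le (M : ℕ) (hM : 0 < M) (a h : ℤ) :
    ((Finset.range M).filter fun x : ℕ => (M : ℤ) ∣ a + h * x).card ≤ Int.gcd h M := by
  set g := Int.gcd h M with hg
  have hg0 : 0 < g := Int.gcd_pos_of_ne_zero_right _ (by exact_mod_cast hM.ne')
  obtain ⟨K, hK⟩ : g ∣ M := by
    have := Int.gcd_dvd_right h (M : ℤ)
    exact_mod_cast this
  have hK0 : 0 < K := Nat.pos_of_ne_zero (by rintro rfl; omega)
  -- With `M = g * K`, two solutions differ by a multiple of `K`, since `h / g` is prime to `K`.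
  -- Hence `x / K`, a number below `g`, tells the solutions apart.
  have key : ∀ x y : ℕ, (M : ℤ) ∣ a + h * x → (M : ℤ) ∣ a + h * y → (K : ℤ) ∣ (x : ℤ) - y := by
    intro x y hx hy
    have h1 : (M : ℤ) ∣ h * ((x : ℤ) - y) := by
      have := dvd_sub hx hy
      ring_nf at this ⊢
      exact this
    obtain ⟨q, hq⟩ := Int.gcd_dvd_left h (M : ℤ)
    rw [← hg] at hq
    have hco : IsCoprime (K : ℤ) q := by
      rw [Int.isCoprime_iff_gcd_eq_one, Int.gcd_comm]
      have h2 : Int.gcd (g * q) (g * K) = g * Int.gcd q K := by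
        rw [Int.gcd_mul_left]; simp
      rw [← hq] at h2
      have h3 : ((g : ℤ) * K) = M := by rw [hK]; push_cast; rfl
      rw [h3, ← hg] at h2
      exact Nat.eq_of_mul_eq_mul_left hg0 (by rw [← h2, mul_one])
    have h3 : (g : ℤ) * K ∣ g * (q * ((x : ℤ) - y)) := by
      have h4 : ((g : ℤ) * K) = M := by rw [hK]; push_cast; rfl
      rw [h4, ← mul_assoc, ← hq]; exact h1
    exact hco.dvd_of_dvd_mul_left
      ((mul_dvd_mul_iff_left (by exact_mod_cast hg0.ne')).1 h3)
  rw [← Finset.card_range g]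
  refine Finset.card_le_card_of_injOn (fun x => x / K) ?_ ?_
  · intro x hx
    simp only [Finset.coe_filter, Finset.mem_range, Set.mem_ofPred_eq, Finset.coe_range,
      Set.mem_Iio] at hx ⊢
    exact (Nat.div_lt_iff_lt_mul hK0).2 (by rw [← hK]; exact hx.1)
  · intro x hx y hy hxy
    simp only [Finset.coe_filter, Finset.mem_range, Set.mem_ofPred_eq] at hx hy hxy
    have h1 := (Nat.modEq_iff_dvd.2 (key y x hy.2 hx.2) : x ≡ y [MOD K])
    rw [← Nat.div_add_mod x K, ← Nat.div_add_mod y K, hxy, h1]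

lemma gcd_eq_of_dvd_add {M : ℕ} {a h : ℤ} {x : ℕ} (hx : Nat.Coprime x M)
    (hd : (M : ℤ) ∣ a + h * x) : Int.gcd a M = Int.gcd h M := by
  have h1 : Int.gcd (h * x) M = Int.gcd h M := by
    have : IsCoprime (x : ℤ) (M : ℤ) := by exact_mod_cast Nat.Coprime.isCoprime hx
    rw [mul_comm]
    refine Int.gcd_mul_right_left_of_gcd_eq_one ?_
    exact Int.isCoprime_iff_gcd_eq_one.1 this
  rw [← h1]
  obtain ⟨k, hk⟩ := hd
  have : a = -(h * x) + M * k := by linarith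
  rw [this, Int.gcd_add_mul_left_left, Int.neg_gcd]

/-! ### Frequency weights -/

/-- The contribution `|k|^{-β}` of a nonzero frequency; zero for `k = 0`. -/
def freqTerm (β : ℝ) (k : ℤ) : ℝ≥0∞ := if k = 0 then 0 else (ENNReal.ofReal (|(k : ℝ)| ^ β))⁻¹

/-- The factor `g ^ (-β)` released by `g * q` absorbs the multiplicity `g`, because `β ≥ 1`. It pays
for the up to `g` solutions of a congruence. -/
lemma freqTerm_mul_le {β : ℝ} (hβ : 1 ≤ β) {g : ℕ} (hg : 0 < g) (q : ℤ) :
    freqTerm β (g * q) * g ≤ freqTerm β q := by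
  unfold freqTerm
  have hg' : (g : ℤ) ≠ 0 := by exact_mod_cast hg.ne'
  by_cases hq : q = 0
  · simp [hq]
  rw [if_neg (mul_ne_zero hg' hq), if_neg hq]
  have hq0 : 0 < |(q : ℝ)| := abs_pos.2 (by exact_mod_cast hq)
  have hg1 : (1 : ℝ) ≤ g := by exact_mod_cast hg
  push_cast
  rw [abs_mul, Nat.abs_cast, Real.mul_rpow (by positivity) (by positivity),
    ENNReal.ofReal_mul (by positivity), ENNReal.mul_inv (by left; simp; positivity) (by simp),
    mul_right_comm]
  calc _ ≤ (1 : ℝ≥0∞) * (ENNReal.ofReal (|(q : ℝ)| ^ β))⁻¹ := by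
        gcongr
        rw [mul_comm, ← div_eq_mul_inv]
        apply ENNReal.div_le_of_le_mul
        rw [one_mul, ← ENNReal.ofReal_natCast]
        apply ENNReal.ofReal_le_ofReal
        calc (g : ℝ) = (g : ℝ) ^ (1 : ℝ) := by simp
          _ ≤ _ := Real.rpow_le_rpow_of_exponent_le hg1 hβ
    _ = _ := one_mul _

lemma freqTerm_rpow {β lam : ℝ} (hl : 0 < lam) (k : ℤ) :
    freqTerm β k ^ lam = freqTerm (β * lam) k := by
  unfold freqTerm
  split_ifs with h
  · simp [hl]
  have : 0 < |(k : ℝ)| := abs_pos.2 (by exact_mod_cast h)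
  rw [ENNReal.inv_rpow, ENNReal.ofReal_rpow_of_nonneg (by positivity) hl.le,
    Real.rpow_mul this.le]

lemma freqTerm_ne_top (β : ℝ) (k : ℤ) : freqTerm β k ≠ ⊤ := by
  unfold freqTerm
  split_ifs with h
  · simp
  have : 0 < |(k : ℝ)| := abs_pos.2 (by exact_mod_cast h)
  simp; positivity

lemma freqTerm_ne_zero (β : ℝ) {k : ℤ} (h : k ≠ 0) : freqTerm β k ≠ 0 := by
  simp [freqTerm, h]

/-- Summing over all units `x`, the frequencies solving `a + h x ≡ 0` have total weight at most
that of all frequencies. -/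
lemma sum_units_freqTerm_le {β : ℝ} (hβ : 1 ≤ β) {M : ℕ} (hM : 0 < M) (a : ℤ) :
    ∑ x ∈ unitsMod M, ∑' h : ℤ, (if (M : ℤ) ∣ a + h * x then freqTerm β h else 0) ≤
      ∑' h, freqTerm β h := by
  set g := Int.gcd a M with hg
  have hg0 : 0 < g := Int.gcd_pos_of_ne_zero_right _ (by exact_mod_cast hM.ne')
  rw [← Summable.tsum_finsetSum (fun _ _ => ENNReal.summable)]
  have hinj : Function.Injective fun q : ℤ => (g : ℤ) * q :=
    mul_right_injective₀ (by exact_mod_cast hg0.ne')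
  have hsum : ∀ h : ℤ, ∑ x ∈ unitsMod M, (if (M : ℤ) ∣ a + h * x then freqTerm β h else 0) =
      ((unitsMod M).filter fun x : ℕ => (M : ℤ) ∣ a + h * x).card * freqTerm β h := by
    intro h
    rw [← Finset.sum_filter, Finset.sum_const, nsmul_eq_mul]
  simp_rw [hsum]
  -- Only the multiples `g * q` contribute: a unit solving the congruence forces `gcd(h, M) = gcd(a,
  -- M) = g`.
  rw [← hinj.tsum_eq]
  · refine ENNReal.tsum_le_tsum fun q => ?_
    rcases Finset.eq_empty_or_nonempty
      ((unitsMod M).filter fun x : ℕ => (M : ℤ) ∣ a + (g * q) * x) with he | ⟨x, hx⟩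
    · simp [he]
    · have hgcd : Int.gcd a M = Int.gcd (g * q) M := by
        simp only [Finset.mem_filter, unitsMod] at hx
        exact gcd_eq_of_dvd_add hx.1.2 hx.2
      refine le_trans ?_ (freqTerm_mul_le hβ hg0 q)
      rw [mul_comm]
      gcongr
      refine (Finset.card_le_card (Finset.filter_subset_filter _ (Finset.filter_subset _ _))).trans
        ((card_linear_congruence_le M hM a (g * q)).trans ?_)
      rw [← hgcd]
  · intro h hh
    have hne : ((unitsMod M).filter fun x : ℕ => (M : ℤ) ∣ a + h * x).Nonempty := by
      rw [Finset.nonempty_iff_ne_empty]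
      intro he
      simp [he] at hh
    obtain ⟨x, hx⟩ := hne
    simp only [Finset.mem_filter, unitsMod] at hx
    have hgcd := gcd_eq_of_dvd_add hx.1.2 hx.2
    obtain ⟨q, hq⟩ := Int.gcd_dvd_left h (M : ℤ)
    exact ⟨q, by simp only [hg, hgcd]; exact hq.symm⟩

/-- A finite set of functions lies in the product of its coordinate projections, over which a sum of
products factors. -/
lemma tsum_pi_prod_le {ι κ : Type*} [Fintype ι] [DecidableEq ι] (f : ι → κ → ℝ≥0∞) :
    ∑' h : ι → κ, ∏ j, f j (h j) ≤ ∏ j, ∑' k, f j k := by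
  classical
  rw [ENNReal.tsum_eq_iSup_sum]
  refine iSup_le fun S => ?_
  calc ∑ h ∈ S, ∏ j, f j (h j)
      ≤ ∑ h ∈ Fintype.piFinset fun j => S.image fun h => h j, ∏ j, f j (h j) := by
        refine Finset.sum_le_sum_of_subset fun h hh => ?_
        exact Fintype.mem_piFinset.2 fun j => Finset.mem_image_of_mem (fun h => h j) hh
    _ = ∏ j, ∑ k ∈ S.image fun h => h j, f j k := (Finset.prod_univ_sum _ _).symm
    _ ≤ _ := Finset.prod_le_prod' fun j _ => ENNReal.sum_le_tsum _

/-- Jensen's inequality for sums, from the subadditivity of `t ↦ t ^ p`. It is what brings the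
exponent `λ` into the error bound. -/
lemma rpow_tsum_le {κ : Type*} (f : κ → ℝ≥0∞) {p : ℝ} (hp : 0 < p) (hp1 : p ≤ 1) :
    (∑' k, f k) ^ p ≤ ∑' k, f k ^ p := by
  rw [ENNReal.tsum_eq_iSup_sum, ← ENNReal.le_rpow_inv_iff hp]
  refine iSup_le fun S => ?_
  rw [ENNReal.le_rpow_inv_iff hp]
  refine le_trans ?_ (ENNReal.sum_le_tsum S)
  classical
  induction S using Finset.induction_on with
  | empty => simp [hp]
  | insert a S ha ih =>
    rw [Finset.sum_insert ha, Finset.sum_insert ha]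
    exact (ENNReal.rpow_add_le_add_rpow _ _ hp.le hp1).trans (by gcongr)

lemma tsum_freqTerm_ne_top {β : ℝ} (hβ : 1 < β) : ∑' k, freqTerm β k ≠ ⊤ := by
  have hs : Summable fun k : ℤ => |(k : ℝ)| ^ (-β) := Real.summable_abs_int_rpow hβ
  refine ne_top_of_le_ne_top (hs.tsum_ofReal_ne_top) (ENNReal.tsum_le_tsum fun k => ?_)
  unfold freqTerm
  split_ifs with h
  · simp
  · have : 0 < |(k : ℝ)| := abs_pos.2 (by exact_mod_cast h)
    rw [Real.rpow_neg this.le, ENNReal.ofReal_inv_of_pos (by positivity)]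

lemma riemannZeta_re_eq_tsum {β : ℝ} (hβ : 1 < β) :
    (riemannZeta (β : ℂ)).re = ∑' n : ℕ, 1 / (n : ℝ) ^ β := by
  rw [zeta_eq_tsum_one_div_nat_cpow (by simpa using hβ)]
  have : ∀ n : ℕ, (1 / (n : ℂ) ^ (β : ℂ)) = ((1 / (n : ℝ) ^ β : ℝ) : ℂ) := by
    intro n
    rw [← Complex.ofReal_natCast, ← Complex.ofReal_cpow (by positivity)]; push_cast; rfl
  simp_rw [this]
  rw [← Complex.ofReal_tsum, Complex.ofReal_re]

lemma riemannZeta_re_nonneg {β : ℝ} (hβ : 1 < β) : 0 ≤ (riemannZeta (β : ℂ)).re := by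
  rw [riemannZeta_re_eq_tsum hβ]
  exact tsum_nonneg fun n => by positivity

lemma tsum_freqTerm_eq {β : ℝ} (hβ : 1 < β) :
    ∑' k, freqTerm β k = ENNReal.ofReal (2 * (riemannZeta (β : ℂ)).re) := by
  have hz := riemannZeta_re_eq_tsum hβ
  have hsn : Summable fun n : ℕ => 1 / (n : ℝ) ^ β := Real.summable_one_div_nat_rpow.2 hβ
  have hshift : ∑' n : ℕ, 1 / (n : ℝ) ^ β = ∑' n : ℕ, 1 / ((n : ℝ) + 1) ^ β := by
    rw [hsn.tsum_eq_zero_add]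
    simp [Real.zero_rpow (by linarith : β ≠ 0)]
  have hs1 : Summable fun n : ℕ => 1 / ((n : ℝ) + 1) ^ β := by
    have := (summable_nat_add_iff 1).2 hsn
    simpa using this
  have hpos : ∀ n : ℕ, freqTerm β (n + 1 : ℤ) = ENNReal.ofReal (1 / ((n : ℝ) + 1) ^ β) := by
    intro n
    have h0 : (n : ℤ) + 1 ≠ 0 := by omega
    unfold freqTerm
    rw [if_neg h0, one_div, ENNReal.ofReal_inv_of_pos (by positivity)]
    push_cast
    rw [abs_of_nonneg (by positivity)]
  have hneg : ∀ k : ℤ, freqTerm β (-k) = freqTerm β k := by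
    intro k; simp [freqTerm]
  have h3 : ∑' n : ℕ, freqTerm β (n + 1 : ℤ) = ENNReal.ofReal (riemannZeta (β : ℂ)).re := by
    simp_rw [hpos]
    rw [← ENNReal.ofReal_tsum_of_nonneg (fun n => by positivity) hs1, hz, hshift]
  rw [tsum_of_nat_of_neg_add_one (f := freqTerm β) ENNReal.summable ENNReal.summable,
    tsum_eq_zero_add' ENNReal.summable]
  have h4 : ∀ n : ℕ, freqTerm β (-(n + 1 : ℤ)) = freqTerm β (n + 1 : ℤ) := fun n => hneg _
  simp_rw [h4]
  push_cast
  rw [h3]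
  have h00 : freqTerm β 0 = 0 := by simp [freqTerm]
  rw [h00, zero_add, ← ENNReal.ofReal_add (riemannZeta_re_nonneg hβ) (riemannZeta_re_nonneg hβ),
    two_mul]

/-! ### Weights of frequency vectors -/

variable {s : ℕ}

/-- The product over `u` of the contributions of the components of `h`, provided that `h` vanishes
outside `u`. -/
def freqProd {s : ℕ} (β : ℝ) (u : Finset (Fin s)) (h : Fin s → ℤ) : ℝ≥0∞ :=
  ∏ j, if j ∈ u then freqTerm β (h j) else if h j = 0 then 1 else 0

/-- The reciprocal of the weight with which the frequency `h` enters the Korobov norm. -/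
def freqWeight {s : ℕ} (β : ℝ) (γ : Finset (Fin s) → ℝ) (h : Fin s → ℤ) : ℝ≥0∞ :=
  ENNReal.ofReal (γ (freqSupport h)) * ∏ j ∈ freqSupport h, freqTerm β (h j)


lemma mem_freqSupport {h : Fin s → ℤ} {j : Fin s} : j ∈ freqSupport h ↔ h j ≠ 0 := by
  simp [freqSupport]

/-- A zero entry inside `u` is killed by `freqTerm β 0 = 0`, a nonzero entry outside `u` by the
other branch. Sums over all `u` therefore have a single nonzero term at each `h`. -/
lemma freqProd_eq_zero (β : ℝ) {u : Finset (Fin s)} {h : Fin s → ℤ} (hu : freqSupport h ≠ u) :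
    freqProd β u h = 0 := by
  rw [freqProd, Finset.prod_eq_zero_iff]
  by_contra hcon
  push Not at hcon
  apply hu
  ext j
  have := hcon j (Finset.mem_univ j)
  rw [mem_freqSupport]
  by_cases hj : j ∈ u <;> by_cases h0 : h j = 0 <;> simp_all [freqTerm]

lemma freqProd_freqSupport (β : ℝ) (h : Fin s → ℤ) :
    freqProd β (freqSupport h) h = ∏ j ∈ freqSupport h, freqTerm β (h j) := by
  rw [freqProd, ← Finset.prod_subset (Finset.subset_univ (freqSupport h))]
  · exact Finset.prod_congr rfl fun j hj => if_pos hj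
  · intro j _ hj
    rw [if_neg hj, if_pos]
    simpa [mem_freqSupport] using hj

lemma freqWeight_rpow (β : ℝ) (γ : Finset (Fin s) → ℝ) (h : Fin s → ℤ) {lam : ℝ} (hl : 0 < lam) :
    freqWeight β γ h ^ lam = ∑ u, ENNReal.ofReal (γ u) ^ lam * freqProd (β * lam) u h := by
  rw [Finset.sum_eq_single (freqSupport h)]
  · rw [freqProd_freqSupport, freqWeight, ENNReal.mul_rpow_of_nonneg _ _ hl.le,
      ← ENNReal.prod_rpow_of_nonneg hl.le]
    simp_rw [freqTerm_rpow hl]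
  · intro u _ hu
    rw [freqProd_eq_zero _ hu.symm, mul_zero]
  · simp

lemma tsum_freqProd_le (β : ℝ) (u : Finset (Fin s)) :
    ∑' h, freqProd β u h ≤ (∑' k, freqTerm β k) ^ u.card := by
  refine (tsum_pi_prod_le fun j k => if j ∈ u then freqTerm β k else if k = 0 then 1 else 0).trans
    (le_of_eq ?_)
  have : ∀ j, (∑' k, if j ∈ u then freqTerm β k else if k = 0 then 1 else 0) =
      if j ∈ u then ∑' k, freqTerm β k else 1 := by
    intro j; split_ifs <;> simp
  simp_rw [this]
  rw [Finset.prod_ite, Finset.prod_const_one, mul_one, Finset.prod_const, Finset.filter_mem_eq_inter,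
    Finset.univ_inter]

lemma tsum_freqWeight_ne_top {β : ℝ} (hβ : 1 < β) (γ : Finset (Fin s) → ℝ) :
    ∑' h, freqWeight β γ h ≠ ⊤ := by
  have h1 : ∀ h, freqWeight β γ h = ∑ u, ENNReal.ofReal (γ u) * freqProd β u h := by
    intro h
    simpa using freqWeight_rpow β γ h one_pos
  simp_rw [h1]
  rw [Summable.tsum_finsetSum (fun _ _ => ENNReal.summable)]
  refine ENNReal.sum_ne_top.2 fun u _ => ?_
  rw [ENNReal.tsum_mul_left]
  exact ENNReal.mul_ne_top ENNReal.ofReal_ne_top (ne_top_of_le_ne_top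
    (ENNReal.pow_ne_top (tsum_freqTerm_ne_top hβ)) (tsum_freqProd_le β u))

/-- The frequencies that are not integrated exactly by the lattice rule, together with zero. -/
def dualLattice (N : ℕ) (z : Fin s → ℕ) : Set (Fin s → ℤ) := {h | (N : ℤ) ∣ ∑ j, h j * z j}

/-- Splitting off the entry `k` of the frequency at `d` leaves, for fixed remaining entries, a
linear congruence in the unit `x`, to which `sum_units_freqTerm_le` applies; the remaining entries
are then summed without any restriction. -/
lemma sum_units_freqProd_le {β : ℝ} (hβ : 1 ≤ β) {b m : ℕ} (hb : 0 < b) (w z : Fin s → ℕ)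
    (d : Fin s) (hd : w d < m) {u : Finset (Fin s)} (hu : d ∈ u) :
    ∑ x ∈ unitsMod (b ^ (m - w d)),
      ∑' h, (dualLattice (b ^ m) (genVector b w (Function.update z d x))).indicator
        (freqProd β u) h ≤ (∑' k, freqTerm β k) ^ u.card := by
  classical
  set Z := ∑' k, freqTerm β k with hZ
  set e := (Equiv.funSplitAt d ℤ).symm with he
  have he1 : ∀ p : ℤ × ({j // j ≠ d} → ℤ), e p d = p.1 := by
    intro p; simp [he, Equiv.funSplitAt, Equiv.piSplitAt]
  have he2 : ∀ (p : ℤ × ({j // j ≠ d} → ℤ)) (j : {j // j ≠ d}), e p j = p.2 j := by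
    intro p j; simp [he, Equiv.funSplitAt, Equiv.piSplitAt, j.2]
  set κ : Fin s → ℤ → ℝ≥0∞ := fun j k => if j ∈ u then freqTerm β k else if k = 0 then 1 else 0
    with hκ
  set R : ({j // j ≠ d} → ℤ) → ℝ≥0∞ := fun r => ∏ j : {j // j ≠ d}, κ j (r j) with hR
  set A : ({j // j ≠ d} → ℤ) → ℤ := fun r => ∑ j : {j // j ≠ d}, r j * (b ^ w j * z j : ℕ) with hA
  set M := b ^ (m - w d) with hMdef
  have hM : 0 < M := by positivity
  have hbm : (b : ℤ) ^ m = (b : ℤ) ^ w d * M := by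
    rw [hMdef]; push_cast; rw [← pow_add]; congr 1; omega
  have hprod : ∀ p, freqProd β u (e p) = freqTerm β p.1 * R p.2 := by
    intro p
    rw [freqProd, Fintype.prod_eq_mul_prod_subtype_ne _ d, he1, if_pos hu]
    simp_rw [he2]; rfl
  have hdot : ∀ (x : ℕ) p, ∑ j, e p j * ((genVector b w (Function.update z d x) j : ℕ) : ℤ) =
      A p.2 + b ^ w d * (p.1 * x) := by
    intro x p
    rw [Fintype.sum_eq_add_sum_subtype_ne _ d, he1, add_comm]
    congr 1
    · refine Finset.sum_congr rfl fun j _ => ?_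
      rw [he2, genVector, Function.update_of_ne j.2]
    · simp [genVector]; ring
  have hinner : ∀ r, ∑ x ∈ unitsMod M, ∑' k : ℤ,
      (dualLattice (b ^ m) (genVector b w (Function.update z d x))).indicator
        (freqProd β u) (e (k, r)) ≤ Z * R r := by
    intro r
    -- Membership in the dual lattice reads `b ^ m ∣ A r + b ^ w d * (k * x)`. Either `b ^ w d`
    -- divides `A r` and cancels, leaving modulus `M`, or there is no solution.
    by_cases hdiv : (b : ℤ) ^ w d ∣ A r
    · obtain ⟨a, ha⟩ := hdiv
      have : ∀ (x : ℕ) (k : ℤ),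
          (dualLattice (b ^ m) (genVector b w (Function.update z d x))).indicator
          (freqProd β u) (e (k, r)) = (if (M : ℤ) ∣ a + k * x then freqTerm β k else 0) * R r := by
        intro x k
        have hiff : e (k, r) ∈ dualLattice (b ^ m) (genVector b w (Function.update z d x)) ↔
            (M : ℤ) ∣ a + k * x := by
          rw [dualLattice, Set.mem_ofPred_eq, hdot]
          simp only
          rw [ha, ← mul_add]
          push_cast
          rw [hbm]
          exact mul_dvd_mul_iff_left (by positivity)
        rw [Set.indicator_apply]
        by_cases hc : (M : ℤ) ∣ a + k * x
        · rw [if_pos (hiff.2 hc), if_pos hc, hprod]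
        · rw [if_neg (fun h => hc (hiff.1 h)), if_neg hc, zero_mul]
      simp_rw [this, ENNReal.tsum_mul_right]
      rw [← Finset.sum_mul]
      gcongr
      exact sum_units_freqTerm_le hβ hM a
    · have : ∀ (x : ℕ) (k : ℤ),
          (dualLattice (b ^ m) (genVector b w (Function.update z d x))).indicator
          (freqProd β u) (e (k, r)) = 0 := by
        intro x k
        refine Set.indicator_of_notMem (fun h => hdiv ?_) _
        rw [dualLattice, Set.mem_ofPred_eq, hdot] at h
        push_cast at h
        rw [hbm] at h
        exact (dvd_add_left (dvd_mul_right _ _)).1 (dvd_of_mul_right_dvd h)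
      simp [this]
  have hswap : ∀ x : ℕ, ∑' h, (dualLattice (b ^ m) (genVector b w (Function.update z d x))).indicator
        (freqProd β u) h = ∑' r, ∑' k : ℤ,
      (dualLattice (b ^ m) (genVector b w (Function.update z d x))).indicator
        (freqProd β u) (e (k, r)) := by
    intro x
    rw [← e.tsum_eq, ENNReal.tsum_prod', ENNReal.tsum_comm]
  simp_rw [hswap]
  rw [← Summable.tsum_finsetSum (fun _ _ => ENNReal.summable)]
  refine (ENNReal.tsum_le_tsum hinner).trans ?_
  rw [ENNReal.tsum_mul_left]
  have hRle : ∑' r, R r ≤ ∏ j : {j // j ≠ d}, if (j : Fin s) ∈ u then Z else 1 := by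
    refine (tsum_pi_prod_le fun (j : {j // j ≠ d}) k => κ j k).trans (le_of_eq ?_)
    refine Finset.prod_congr rfl fun j _ => ?_
    simp only [hκ]
    split_ifs <;> simp [hZ]
  calc Z * ∑' r, R r ≤ Z * ∏ j : {j // j ≠ d}, (if (j : Fin s) ∈ u then Z else 1) := by gcongr
    _ = ∏ j, if j ∈ u then Z else 1 := by
        rw [Fintype.prod_eq_mul_prod_subtype_ne _ d, if_pos hu]
    _ = Z ^ u.card := by
        rw [Finset.prod_ite, Finset.prod_const_one, mul_one, Finset.prod_const,
          Finset.filter_mem_eq_inter, Finset.univ_inter]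

/-! ### The error sum over the dual lattice -/

/-- The sum of the frequency weights over the dual lattice points in `A`. -/
def dualSum (β : ℝ) (γ : Finset (Fin s) → ℝ) (N : ℕ) (z : Fin s → ℕ) (A : Set (Fin s → ℤ)) :
    ℝ≥0∞ :=
  ∑' h : ↥(A ∩ dualLattice N z), freqWeight β γ h

/-- The nonzero frequencies involving only the first `d` components. -/
def prefixFreq (s d : ℕ) : Set (Fin s → ℤ) := {h | h ≠ 0 ∧ ∀ j : Fin s, d ≤ j.val → h j = 0}

/-- The frequencies whose last nonzero component is the component `d`. -/
def lastFreq (d : Fin s) : Set (Fin s → ℤ) := {h | h d ≠ 0 ∧ ∀ j, d < j → h j = 0}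

lemma prefixFreq_zero : prefixFreq s 0 = ∅ := by
  ext h
  simp only [prefixFreq, Set.mem_ofPred_eq, Set.mem_empty_iff_false, iff_false, not_and]
  intro h0 h1
  exact h0 (funext fun j => h1 j (Nat.zero_le _))

lemma prefixFreq_succ (d : Fin s) :
    prefixFreq s (d.val + 1) = prefixFreq s d.val ∪ lastFreq d := by
  ext h
  simp only [prefixFreq, lastFreq, Set.mem_ofPred_eq, Set.mem_union]
  constructor
  · rintro ⟨h0, h1⟩
    by_cases hd : h d = 0
    · refine Or.inl ⟨h0, fun j hj => ?_⟩
      rcases hj.eq_or_lt with hj | hj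
      · rwa [← Fin.ext hj]
      · exact h1 j hj
    · exact Or.inr ⟨hd, fun j hj => h1 j hj⟩
  · rintro (⟨h0, h1⟩ | ⟨h0, h1⟩)
    · exact ⟨h0, fun j hj => h1 j (by omega)⟩
    · exact ⟨fun hh => h0 (by simp [hh]), fun j hj => h1 j hj⟩

lemma disjoint_prefixFreq_lastFreq (d : Fin s) : Disjoint (prefixFreq s d.val) (lastFreq d) := by
  rw [Set.disjoint_left]
  rintro h ⟨_, h1⟩ ⟨h2, _⟩
  exact h2 (h1 d le_rfl)

lemma prefixFreq_self : prefixFreq s s = {h | h ≠ 0} := by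
  ext h
  simp only [prefixFreq, Set.mem_ofPred_eq, and_iff_left_iff_imp]
  intro _ j hj
  exact absurd j.isLt (by omega)

lemma dualSum_prefixFreq_succ (β : ℝ) (γ : Finset (Fin s) → ℝ) (N : ℕ) (z : Fin s → ℕ)
    (d : Fin s) :
    dualSum β γ N z (prefixFreq s (d.val + 1)) =
      dualSum β γ N z (prefixFreq s d.val) + dualSum β γ N z (lastFreq d) := by
  rw [dualSum, prefixFreq_succ, Set.union_inter_distrib_right]
  exact ENNReal.summable.tsum_union_disjoint ((disjoint_prefixFreq_lastFreq d).mono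
    Set.inter_subset_left Set.inter_subset_left) ENNReal.summable

lemma dualSum_ne_top {β : ℝ} (hβ : 1 < β) (γ : Finset (Fin s) → ℝ) (N : ℕ) (z : Fin s → ℕ)
    (A : Set (Fin s → ℤ)) : dualSum β γ N z A ≠ ⊤ :=
  ne_top_of_le_ne_top (tsum_freqWeight_ne_top hβ γ)
    (ENNReal.tsum_comp_le_tsum_of_injective Subtype.val_injective _)

lemma dualSum_prefixFreq_congr (β : ℝ) (γ : Finset (Fin s) → ℝ) (N : ℕ) {z z' : Fin s → ℕ}
    (d : ℕ) (hz : ∀ j : Fin s, j.val < d → z j = z' j) :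
    dualSum β γ N z (prefixFreq s d) = dualSum β γ N z' (prefixFreq s d) := by
  have : prefixFreq s d ∩ dualLattice N z = prefixFreq s d ∩ dualLattice N z' := by
    ext h
    simp only [Set.mem_inter_iff, and_congr_right_iff, dualLattice, Set.mem_ofPred_eq]
    rintro ⟨_, h1⟩
    have : ∑ j, h j * (z j : ℤ) = ∑ j, h j * (z' j : ℤ) := by
      refine Finset.sum_congr rfl fun j _ => ?_
      by_cases hj : j.val < d
      · rw [hz j hj]
      · rw [h1 j (by omega), zero_mul, zero_mul]
    rw [this]
  rw [dualSum, dualSum, this]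

/-- The sets of components whose last element is `d`. -/
def lastSets (d : Fin s) : Finset (Finset (Fin s)) :=
  Finset.univ.filter fun u => d ∈ u ∧ ∀ j ∈ u, j ≤ d

lemma freqWeight_rpow_of_mem_lastFreq (β : ℝ) (γ : Finset (Fin s) → ℝ) {d : Fin s}
    {h : Fin s → ℤ} (hh : h ∈ lastFreq d) {lam : ℝ} (hl : 0 < lam) :
    freqWeight β γ h ^ lam =
      ∑ u ∈ lastSets d, ENNReal.ofReal (γ u) ^ lam * freqProd (β * lam) u h := by
  rw [freqWeight_rpow β γ h hl]
  symm
  refine Finset.sum_subset (Finset.subset_univ _) fun u _ hu => ?_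
  rw [freqProd_eq_zero, mul_zero]
  rintro rfl
  apply hu
  simp only [lastSets, Finset.mem_filter, Finset.mem_univ, true_and, mem_freqSupport]
  refine ⟨hh.1, fun j hj => ?_⟩
  by_contra hlt
  exact hj (hh.2 j (not_le.1 hlt))

/-- After Jensen's inequality the power of each weight splits over the sets in `lastSets d`. The
restriction to `lastFreq d` can then be dropped, which only enlarges the sum. -/
lemma dualSum_lastFreq_rpow_le (β : ℝ) (γ : Finset (Fin s) → ℝ) (N : ℕ) (z : Fin s → ℕ)
    (d : Fin s) {lam : ℝ} (hl : 0 < lam) (hl1 : lam ≤ 1) :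
    dualSum β γ N z (lastFreq d) ^ lam ≤ ∑ u ∈ lastSets d, ENNReal.ofReal (γ u) ^ lam *
      ∑' h, (dualLattice N z).indicator (freqProd (β * lam) u) h := by
  refine (rpow_tsum_le _ hl hl1).trans ?_
  simp_rw [← ENNReal.tsum_mul_left]
  rw [← Summable.tsum_finsetSum (fun _ _ => ENNReal.summable)]
  have : ∀ h : ↥(lastFreq d ∩ dualLattice N z), freqWeight β γ h ^ lam =
      ∑ u ∈ lastSets d, ENNReal.ofReal (γ u) ^ lam *
        (dualLattice N z).indicator (freqProd (β * lam) u) h := by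
    intro h
    rw [freqWeight_rpow_of_mem_lastFreq β γ h.2.1 hl]
    refine Finset.sum_congr rfl fun u _ => ?_
    rw [Set.indicator_of_mem h.2.2]
  simp_rw [this]
  exact ENNReal.tsum_comp_le_tsum_of_injective Subtype.val_injective
    (fun h => ∑ u ∈ lastSets d, ENNReal.ofReal (γ u) ^ lam *
        (dualLattice N z).indicator (freqProd (β * lam) u) h)

/-- The count is `φ(b ^ n) = b ^ (n - 1) * (b - 1)`, and `b ≤ 2 * (b - 1)`. This is the source of
the 2 in `2 / N`. -/
lemma unitsMod_card_bound {b : ℕ} (hb : b.Prime) {n : ℕ} (hn : 0 < n) :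
    b ^ n ≤ 2 * (unitsMod (b ^ n)).card := by
  have h1 : (unitsMod (b ^ n)).card = Nat.totient (b ^ n) := by
    rw [unitsMod, Nat.totient_eq_card_coprime]
    congr 1
    refine Finset.filter_congr fun x _ => ?_
    rw [Nat.coprime_comm]
  rw [h1, Nat.totient_prime_pow hb hn]
  obtain ⟨k, rfl⟩ : ∃ k, n = k + 1 := ⟨n - 1, by omega⟩
  have h2 := hb.two_le
  rw [Nat.add_sub_cancel, pow_succ]
  have : b ≤ 2 * (b - 1) := by omega
  calc b ^ k * b ≤ b ^ k * (2 * (b - 1)) := Nat.mul_le_mul_left _ this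
    _ = _ := by ring

/-- The minimum is at most the average over the units, and that average is controlled by
`sum_units_freqProd_le`. -/
lemma dualSum_lastFreq_bound {b : ℕ} (hb : b.Prime) {m : ℕ} (w z : Fin s → ℕ)
    (γ : Finset (Fin s) → ℝ) {β : ℝ} (d : Fin s) {lam : ℝ} (hl : 0 < lam) (hl1 : lam ≤ 1)
    (hβ : 1 ≤ β * lam)
    (hmin : w d < m → ∀ x ∈ unitsMod (b ^ (m - w d)),
      dualSum β γ (b ^ m) (genVector b w z) (lastFreq d) ≤
        dualSum β γ (b ^ m) (genVector b w (Function.update z d x)) (lastFreq d)) :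
    dualSum β γ (b ^ m) (genVector b w z) (lastFreq d) ^ lam ≤
      (∑ u ∈ lastSets d, ENNReal.ofReal (γ u) ^ lam * (∑' k, freqTerm (β * lam) k) ^ u.card) *
        ((b : ℝ≥0∞) ^ min m (w d) * (2 / (b : ℝ≥0∞) ^ m)) := by
  set Z := ∑' k, freqTerm (β * lam) k
  have hb0 : (b : ℝ≥0∞) ≠ 0 := by exact_mod_cast hb.ne_zero
  have hbt : (b : ℝ≥0∞) ≠ ⊤ := ENNReal.natCast_ne_top b
  rcases lt_or_ge (w d) m with hlt | hge
  · set M := b ^ (m - w d) with hM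
    have hcard := unitsMod_card_bound hb (n := m - w d) (by omega)
    rw [← hM] at hcard
    have hM0 : 0 < M := pow_pos hb.pos _
    have hc0 : 0 < (unitsMod M).card := by omega
    have key : ((unitsMod M).card : ℝ≥0∞) *
        dualSum β γ (b ^ m) (genVector b w z) (lastFreq d) ^ lam ≤
        ∑ u ∈ lastSets d, ENNReal.ofReal (γ u) ^ lam * Z ^ u.card := by
      rw [← nsmul_eq_mul]
      calc _ ≤ ∑ x ∈ unitsMod M,
            dualSum β γ (b ^ m) (genVector b w (Function.update z d x)) (lastFreq d) ^ lam :=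
            Finset.card_nsmul_le_sum _ _ _ fun x hx =>
              ENNReal.rpow_le_rpow (hmin hlt x hx) hl.le
        _ ≤ ∑ x ∈ unitsMod M, ∑ u ∈ lastSets d, ENNReal.ofReal (γ u) ^ lam *
              ∑' h, (dualLattice (b ^ m) (genVector b w (Function.update z d x))).indicator
                (freqProd (β * lam) u) h :=
            Finset.sum_le_sum fun x _ => dualSum_lastFreq_rpow_le _ _ _ _ _ hl hl1
        _ ≤ _ := by
            rw [Finset.sum_comm]
            refine Finset.sum_le_sum fun u hu => ?_
            rw [← Finset.mul_sum]
            gcongr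
            simp only [lastSets, Finset.mem_filter] at hu
            exact sum_units_freqProd_le hβ hb.pos w z d hlt hu.2.1
    rw [min_eq_right hlt.le]
    have hc0' : ((unitsMod M).card : ℝ≥0∞) ≠ 0 := by exact_mod_cast hc0.ne'
    have hct : ((unitsMod M).card : ℝ≥0∞) ≠ ⊤ := ENNReal.natCast_ne_top _
    have h1 : ((unitsMod M).card : ℝ≥0∞)⁻¹ ≤ (b : ℝ≥0∞) ^ w d * (2 / (b : ℝ≥0∞) ^ m) := by
      have h2 : (b : ℝ≥0∞) ^ m = (b : ℝ≥0∞) ^ w d * M := by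
        rw [hM]; push_cast; rw [← pow_add]; congr 1; omega
      rw [h2, ENNReal.div_eq_inv_mul, ENNReal.mul_inv (by left; exact pow_ne_zero _ hb0)
        (by left; exact ENNReal.pow_ne_top hbt), ← mul_assoc, ← mul_assoc,
        ENNReal.mul_inv_cancel (pow_ne_zero _ hb0) (ENNReal.pow_ne_top hbt), one_mul]
      have hM0' : (M : ℝ≥0∞) ≠ 0 := by exact_mod_cast hM0.ne'
      rw [← ENNReal.div_eq_inv_mul, ENNReal.le_div_iff_mul_le (by left; exact hM0')
        (by left; exact ENNReal.natCast_ne_top _), ← ENNReal.div_eq_inv_mul]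
      refine ENNReal.div_le_of_le_mul ?_
      exact_mod_cast hcard
    calc _ ≤ (∑ u ∈ lastSets d, ENNReal.ofReal (γ u) ^ lam * Z ^ u.card) *
          ((unitsMod M).card : ℝ≥0∞)⁻¹ := by
          rw [← ENNReal.div_eq_inv_mul.trans (mul_comm _ _),
            ENNReal.le_div_iff_mul_le (by left; exact hc0') (by left; exact hct), mul_comm]
          exact key
      _ ≤ _ := by gcongr
  -- If `m ≤ w d`, nothing is chosen and the dual condition is simply dropped: `b ^ m` cancels
  -- against `N`, and the factor 2 is to spare.
  · rw [min_eq_left hge, ENNReal.mul_div_cancel (pow_ne_zero _ hb0) (ENNReal.pow_ne_top hbt)]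
    refine (dualSum_lastFreq_rpow_le _ _ _ _ _ hl hl1).trans ?_
    refine le_trans ?_ (le_mul_of_one_le_right (by positivity) (by norm_num))
    gcongr with u hu
    refine le_trans ?_ (tsum_freqProd_le _ u)
    exact ENNReal.tsum_le_tsum fun h => Set.indicator_le_self _ _ _

/-- The error bound of the reduced component-by-component construction. -/
lemma dualSum_rpow_le {b : ℕ} (hb : b.Prime) {m : ℕ} {w : Fin s → ℕ} (hw : Monotone w)
    (z : Fin s → ℕ) (γ : Finset (Fin s) → ℝ) {β : ℝ} (hβ1 : 1 < β) {lam : ℝ} (hl : 0 < lam)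
    (hl1 : lam ≤ 1) (hβ : 1 ≤ β * lam)
    (hmin : ∀ d, w d < m → ∀ x ∈ unitsMod (b ^ (m - w d)),
      dualSum β γ (b ^ m) (genVector b w z) (prefixFreq s (d.val + 1)) ≤
        dualSum β γ (b ^ m) (genVector b w (Function.update z d x)) (prefixFreq s (d.val + 1))) :
    dualSum β γ (b ^ m) (genVector b w z) {h | h ≠ 0} ^ lam ≤
      (∑ u : Finset (Fin s) with u.Nonempty, ENNReal.ofReal (γ u) ^ lam *
        (∑' k, freqTerm (β * lam) k) ^ u.card * (b : ℝ≥0∞) ^ min m (u.sup w)) *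
        (2 / (b : ℝ≥0∞) ^ m) := by
  have hmin' : ∀ d, w d < m → ∀ x ∈ unitsMod (b ^ (m - w d)),
      dualSum β γ (b ^ m) (genVector b w z) (lastFreq d) ≤
        dualSum β γ (b ^ m) (genVector b w (Function.update z d x)) (lastFreq d) := by
    intro d hd x hx
    have h1 := hmin d hd x hx
    -- Changing component `d` does not affect the frequencies in earlier components; their common
    -- contribution is finite and cancels.
    rw [dualSum_prefixFreq_succ, dualSum_prefixFreq_succ,
      dualSum_prefixFreq_congr β γ (b ^ m) (z := genVector b w (Function.update z d x))
        (z' := genVector b w z)] at h1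
    · exact (ENNReal.add_le_add_iff_left (dualSum_ne_top hβ1 _ _ _ _)).1 h1
    · intro j hj
      rw [genVector, genVector, Function.update_of_ne]
      rintro rfl
      exact lt_irrefl _ hj
  set Z := ∑' k, freqTerm (β * lam) k
  have main : ∀ d, d ≤ s → dualSum β γ (b ^ m) (genVector b w z) (prefixFreq s d) ^ lam ≤
      ∑ u : Finset (Fin s) with u.Nonempty ∧ ∀ j ∈ u, j.val < d, ENNReal.ofReal (γ u) ^ lam *
        Z ^ u.card * (b : ℝ≥0∞) ^ min m (u.sup w) * (2 / (b : ℝ≥0∞) ^ m) := by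
    intro d
    induction d with
    | zero =>
      intro _
      rw [dualSum, prefixFreq_zero, Set.empty_inter]
      simp [hl]
    | succ d ih =>
      intro hd
      have hsets : (Finset.univ.filter fun u : Finset (Fin s) =>
          u.Nonempty ∧ ∀ j ∈ u, j.val < d + 1) =
          (Finset.univ.filter fun u : Finset (Fin s) => u.Nonempty ∧ ∀ j ∈ u, j.val < d) ∪
            lastSets ⟨d, hd⟩ := by
        ext u
        simp only [lastSets, Finset.mem_filter, Finset.mem_univ, true_and, Finset.mem_union]
        constructor
        · rintro ⟨h0, h1⟩
          by_cases hdu : (⟨d, hd⟩ : Fin s) ∈ u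
          · exact Or.inr ⟨hdu, fun j hj => Nat.lt_succ_iff.1 (h1 j hj)⟩
          · refine Or.inl ⟨h0, fun j hj => ?_⟩
            have := h1 j hj
            have : j.val ≠ d := by
              rintro rfl; exact hdu hj
            omega
        · rintro (⟨h0, h1⟩ | ⟨h0, h1⟩)
          · exact ⟨h0, fun j hj => Nat.lt_succ_of_lt (h1 j hj)⟩
          · exact ⟨⟨_, h0⟩, fun j hj => Nat.lt_succ_iff.2 (h1 j hj)⟩
      have hdisj : Disjoint (Finset.univ.filter fun u : Finset (Fin s) =>
          u.Nonempty ∧ ∀ j ∈ u, j.val < d) (lastSets ⟨d, hd⟩) := by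
        rw [Finset.disjoint_left]
        intro u hu hu'
        simp only [lastSets, Finset.mem_filter] at hu hu'
        exact absurd (hu.2.2 _ hu'.2.1) (by simp)
      rw [hsets, Finset.sum_union hdisj]
      have h1 := dualSum_prefixFreq_succ β γ (b ^ m) (genVector b w z) ⟨d, hd⟩
      simp only at h1
      rw [h1]
      refine (ENNReal.rpow_add_le_add_rpow _ _ hl.le hl1).trans (add_le_add (ih (by omega)) ?_)
      refine (dualSum_lastFreq_bound hb w z γ ⟨d, hd⟩ hl hl1 hβ (hmin' _)).trans (le_of_eq ?_)
      rw [Finset.sum_mul]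
      refine Finset.sum_congr rfl fun u hu => ?_
      simp only [lastSets, Finset.mem_filter] at hu
      -- Monotonicity of `w` places the maximum over `u` at its last element `d`.
      have : u.sup w = w ⟨d, hd⟩ :=
        le_antisymm (Finset.sup_le fun j hj => hw (hu.2.2 j hj)) (Finset.le_sup hu.2.1)
      rw [this, ← mul_assoc]
  have := main s le_rfl
  rw [prefixFreq_self] at this
  refine this.trans (le_of_eq ?_)
  rw [Finset.sum_mul]
  refine Finset.sum_congr (Finset.filter_congr fun u _ => ?_) fun _ _ => rfl
  exact and_iff_left fun j _ => j.isLt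

section Torus

/-! ### Fourier analysis on the torus -/

/-- The circle carries its Haar probability measure, as in `UnitAddTorus.mFourierCoeff`. -/
local instance circleMeasureSpace : MeasureSpace UnitAddCircle := ⟨AddCircle.haarAddCircle⟩

local instance circleHaar : Measure.IsAddHaarMeasure (volume : Measure UnitAddCircle) :=
  inferInstanceAs (Measure.IsAddHaarMeasure AddCircle.haarAddCircle)

local instance circleProbability : IsProbabilityMeasure (volume : Measure UnitAddCircle) :=
  inferInstanceAs (IsProbabilityMeasure AddCircle.haarAddCircle)

open UnitAddTorus

lemma mFourierCoeff_mFourier (m n : Fin s → ℤ) :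
    mFourierCoeff (mFourier m) n = if n = m then 1 else 0 := by
  have h := orthonormal_iff_ite.1 (orthonormal_mFourier (d := Fin s)) n m
  rw [← h, ContinuousMap.inner_toLp, mFourierCoeff]
  refine integral_congr_ae (Filter.Eventually.of_forall fun x => ?_)
  simp only [← mFourier_neg, smul_eq_mul]
  ring

lemma mFourierCoeff_sum {ι : Type*} (S : Finset ι) (c : ι → ℂ) (f : ι → C(UnitAddTorus (Fin s), ℂ))
    (n : Fin s → ℤ) :
    mFourierCoeff (∑ i ∈ S, c i • f i : C(UnitAddTorus (Fin s), ℂ)) n =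
      ∑ i ∈ S, c i * mFourierCoeff (f i) n := by
  unfold mFourierCoeff
  have hint : ∀ i, Integrable (fun t => mFourier (-n) t • f i t)
      (volume : Measure (UnitAddTorus (Fin s))) := fun i =>
    (mFourier (-n) • f i).continuous.integrable_of_hasCompactSupport
      (HasCompactSupport.of_compactSpace _)
  simp_rw [← integral_const_mul]
  rw [← integral_finsetSum _ fun i _ => (hint i).const_mul (c i)]
  refine integral_congr_ae (Filter.Eventually.of_forall fun x => ?_)
  simp only [ContinuousMap.coe_sum, Finset.sum_apply, ContinuousMap.coe_smul, Pi.smul_apply,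
    smul_eq_mul, Finset.mul_sum]
  exact Finset.sum_congr rfl fun i _ => by ring

lemma setOf_Ioc_ae_eq_Icc (a b : Fin s → ℝ) :
    ({x : Fin s → ℝ | ∀ i, x i ∈ Set.Ioc (a i) (b i)} : Set (Fin s → ℝ)) =ᵐ[volume]
      Set.Icc a b := by
  have := Measure.univ_pi_Ioc_ae_eq_Icc (μ := fun _ : Fin s => (volume : Measure ℝ))
    (f := a) (g := b)
  rw [← volume_pi] at this
  have h2 : ({x : Fin s → ℝ | ∀ i, x i ∈ Set.Ioc (a i) (b i)} : Set (Fin s → ℝ)) =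
      Set.univ.pi fun i => Set.Ioc (a i) (b i) := Set.ext fun x => by simp
  rwa [h2]

lemma integral_torus_eq {E : Type*} [NormedAddCommGroup E] [NormedSpace ℝ E]
    (f : UnitAddTorus (Fin s) → E) (a : Fin s → ℝ) :
    ∫ x, f x = ∫ x in Set.Icc a (a + 1), f (fun i => (x i : UnitAddCircle)) := by
  rw [integral_preimage f a]
  exact setIntegral_congr_set (setOf_Ioc_ae_eq_Icc a (a + 1))

lemma periodIntegral_eq (f : C(UnitAddTorus (Fin s), ℂ)) :
    periodIntegral f = mFourierCoeff f 0 := by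
  rw [mFourierCoeff, integral_torus_eq _ 0, periodIntegral]
  simp [mFourier_zero]

/-- The lattice point with index `k`, as a point of the torus. -/
def latticePoint (N : ℕ) (z : Fin s → ℕ) (k : ℕ) : UnitAddTorus (Fin s) :=
  fun j => (((k : ℝ) * (z j : ℝ) / (N : ℝ) : ℝ) : UnitAddCircle)

lemma mFourier_latticePoint (N : ℕ) (z : Fin s → ℕ) (k : ℕ) (h : Fin s → ℤ) :
    mFourier h (latticePoint N z k) =
      Complex.exp (2 * Real.pi * Complex.I * ((∑ j, h j * (z j : ℤ) : ℤ) / N)) ^ k := by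
  rw [← Complex.exp_nat_mul]
  simp only [mFourier, ContinuousMap.coe_mk, latticePoint, fourier_coe_apply]
  rw [← Complex.exp_sum]
  congr 1
  push_cast
  rw [Finset.sum_div, Finset.mul_sum, Finset.mul_sum]
  refine Finset.sum_congr rfl fun j _ => ?_
  ring

-- The values at the lattice points are the powers of an `N`-th root of unity `q`, so the sum is
-- geometric; `q = 1` exactly on the dual lattice.
open Classical in
lemma latticeAverage_mFourier {N : ℕ} (hN : 0 < N) (z : Fin s → ℕ) (h : Fin s → ℤ) :
    (1 / (N : ℂ)) * ∑ k ∈ Finset.Icc 1 N, mFourier h (latticePoint N z k) =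
      if h ∈ dualLattice N z then 1 else 0 := by
  simp_rw [mFourier_latticePoint]
  set a : ℤ := ∑ j, h j * (z j : ℤ) with ha
  set q := Complex.exp (2 * Real.pi * Complex.I * ((a : ℂ) / N)) with hq
  have hNc : (N : ℂ) ≠ 0 := by exact_mod_cast hN.ne'
  have hqN : q ^ N = 1 := by
    rw [hq, ← Complex.exp_nat_mul, Complex.exp_eq_one_iff]
    exact ⟨a, by field_simp⟩
  have hq1 : q = 1 ↔ h ∈ dualLattice N z := by
    rw [hq, Complex.exp_eq_one_iff, dualLattice, Set.mem_ofPred_eq, ← ha]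
    have hpi : (2 * Real.pi * Complex.I : ℂ) ≠ 0 := Complex.two_pi_I_ne_zero
    constructor
    · rintro ⟨n, hn⟩
      rw [mul_comm] at hn
      have h1 := mul_right_cancel₀ hpi hn
      rw [div_eq_iff hNc] at h1
      exact ⟨n, by rw [mul_comm]; exact_mod_cast h1⟩
    · rintro ⟨n, hn⟩
      refine ⟨n, ?_⟩
      rw [hn]; push_cast; field_simp
  have hsum : ∑ k ∈ Finset.Icc 1 N, q ^ k = q * ∑ k ∈ Finset.range N, q ^ k := by
    rw [Finset.mul_sum, ← Finset.Ico_succ_right_eq_Icc, Finset.sum_Ico_eq_sum_range]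
    simp [pow_add]
  by_cases hd : h ∈ dualLattice N z
  · rw [if_pos hd, hq1.2 hd]
    simp [hNc]
  · rw [if_neg hd, hsum]
    have : q ≠ 1 := fun h => hd (hq1.1 h)
    rw [geom_sum_eq this, hqN]
    simp

lemma latticeRule_eq (N : ℕ) (z : Fin s → ℕ) (f : C(UnitAddTorus (Fin s), ℂ)) :
    latticeRule N z f = (1 / (N : ℂ)) * ∑ k ∈ Finset.Icc 1 N, f (latticePoint N z k) := rfl

/-! ### The worst-case error in the Korobov space -/

/-- Cauchy-Schwarz without division by `r`, so that vanishing weights are admitted. -/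
lemma tsum_sq_le_of_sq_le_mul {ι : Type*} (a r t : ι → ℝ≥0∞) (h : ∀ i, a i ^ 2 ≤ r i * t i) :
    (∑' i, a i) ^ 2 ≤ (∑' i, r i) * ∑' i, t i := by
  have h1 : ∀ i, a i ≤ r i ^ (1 / 2 : ℝ) * t i ^ (1 / 2 : ℝ) := by
    intro i
    rw [← ENNReal.mul_rpow_of_nonneg _ _ (by norm_num : (0 : ℝ) ≤ 1 / 2)]
    calc a i = (a i ^ (2 : ℕ)) ^ (1 / 2 : ℝ) := by
          rw [← ENNReal.rpow_natCast, ← ENNReal.rpow_mul]; simp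
      _ ≤ _ := ENNReal.rpow_le_rpow (h i) (by norm_num)
  have h2 : ∑' i, a i ≤ (∑' i, r i) ^ (1 / 2 : ℝ) * (∑' i, t i) ^ (1 / 2 : ℝ) := by
    rw [ENNReal.tsum_eq_iSup_sum]
    refine iSup_le fun S => ?_
    calc ∑ i ∈ S, a i ≤ ∑ i ∈ S, r i ^ (1 / 2 : ℝ) * t i ^ (1 / 2 : ℝ) :=
          Finset.sum_le_sum fun i _ => h1 i
      _ ≤ (∑ i ∈ S, (r i ^ (1 / 2 : ℝ)) ^ (2 : ℝ)) ^ (1 / 2 : ℝ) *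
          (∑ i ∈ S, (t i ^ (1 / 2 : ℝ)) ^ (2 : ℝ)) ^ (1 / 2 : ℝ) :=
          ENNReal.inner_le_Lp_mul_Lq S _ _ Real.HolderConjugate.two_two
      _ ≤ _ := by
          simp_rw [← ENNReal.rpow_mul]
          norm_num
          gcongr <;> exact ENNReal.sum_le_tsum _
  calc _ ≤ ((∑' i, r i) ^ (1 / 2 : ℝ) * (∑' i, t i) ^ (1 / 2 : ℝ)) ^ 2 := by gcongr
    _ = _ := by
        rw [mul_pow, ← ENNReal.rpow_natCast, ← ENNReal.rpow_natCast, ← ENNReal.rpow_mul,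
          ← ENNReal.rpow_mul]
        norm_num

lemma freqWeight_ne_top (α : ℝ) (γ : Finset (Fin s) → ℝ) (h : Fin s → ℤ) :
    freqWeight α γ h ≠ ⊤ :=
  ENNReal.mul_ne_top ENNReal.ofReal_ne_top (ENNReal.prod_ne_top fun _ _ => freqTerm_ne_top _ _)

lemma freqWeight_inv (α : ℝ) (γ : Finset (Fin s) → ℝ) (h : Fin s → ℤ) :
    (freqWeight α γ h)⁻¹ = (ENNReal.ofReal (γ (freqSupport h)))⁻¹ *
      ∏ j ∈ freqSupport h, ENNReal.ofReal (|(h j : ℝ)| ^ α) := by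
  have hP : ∏ j ∈ freqSupport h, freqTerm α (h j) ≠ 0 :=
    Finset.prod_ne_zero_iff.2 fun j hj => freqTerm_ne_zero _ (mem_freqSupport.1 hj)
  rw [freqWeight, ENNReal.mul_inv (Or.inr (ENNReal.prod_ne_top fun _ _ => freqTerm_ne_top _ _))
    (Or.inr hP)]
  congr 1
  rw [ENNReal.prod_inv_distrib]
  · refine Finset.prod_congr rfl fun j hj => ?_
    rw [freqTerm, if_neg (mem_freqSupport.1 hj), inv_inv]
  · intro i _ j _ _
    exact Or.inr (freqTerm_ne_top _ _)

lemma korobovNormSq_eq (α : ℝ) (γ : Finset (Fin s) → ℝ) (f : C(UnitAddTorus (Fin s), ℂ)) :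
    korobovNormSq α γ f = ∑' h, (freqWeight α γ h)⁻¹ * ‖mFourierCoeff f h‖ₑ ^ 2 := by
  simp_rw [korobovNormSq, freqWeight_inv]

/-- For `r = 0` the convention `0⁻¹ = ⊤` makes finiteness of `r⁻¹ * c` force `c = 0`: a zero weight
excludes the frequency. -/
lemma le_mul_inv_mul {r c : ℝ≥0∞} (hr : r ≠ ⊤) (h : r⁻¹ * c ≠ ⊤) : c ≤ r * (r⁻¹ * c) := by
  by_cases h0 : r = 0
  · subst h0
    by_cases hc : c = 0
    · simp [hc]
    · simp [ENNReal.top_mul hc] at h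
  · rw [← mul_assoc, ENNReal.mul_inv_cancel h0 hr, one_mul]

/-- Finite norm makes the Fourier series absolutely summable, so the rule may be applied termwise;
the error is the sum of the coefficients over the nonzero dual lattice, and Cauchy-Schwarz against
the weights bounds it. -/
lemma korobovError_sq_le {α : ℝ} (hα : 1 < α) (γ : Finset (Fin s) → ℝ) {N : ℕ} (hN : 0 < N)
    (z : Fin s → ℕ) : korobovError α γ N z ^ 2 ≤ dualSum α γ N z {h | h ≠ 0} := by
  classical
  rw [← ENNReal.rpow_natCast, ← ENNReal.le_rpow_inv_iff (by norm_num)]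
  refine iSup₂_le fun f hf => ?_
  rw [ENNReal.le_rpow_inv_iff (by norm_num), ENNReal.rpow_natCast]
  rw [korobovNormSq_eq] at hf
  set c := mFourierCoeff f with hc
  have hterm : ∀ h, ‖c h‖ₑ ^ 2 ≤
      freqWeight α γ h * ((freqWeight α γ h)⁻¹ * ‖c h‖ₑ ^ 2) := fun h =>
    le_mul_inv_mul (freqWeight_ne_top _ _ _)
      (ne_top_of_le_ne_top ENNReal.one_ne_top ((ENNReal.le_tsum h).trans hf))
  have hsummable : Summable c := by
    have h1 : (∑' h, ‖c h‖ₑ) ^ 2 ≠ ⊤ :=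
      ne_top_of_le_ne_top (ENNReal.mul_ne_top (tsum_freqWeight_ne_top hα γ)
        (ne_top_of_le_ne_top ENNReal.one_ne_top hf)) (tsum_sq_le_of_sq_le_mul _ _ _ hterm)
    have h2 : ∑' h, ‖c h‖ₑ ≠ ⊤ := fun h => by simp [h] at h1
    exact Summable.of_enorm h2
  have hsum := hasSum_mFourier_series_apply_of_summable hsummable
  have hrule : HasSum (fun h => c h * if h ∈ dualLattice N z then 1 else 0) (latticeRule N z f) := by
    rw [latticeRule_eq]
    have h1 := (hasSum_sum fun k (_ : k ∈ Finset.Icc 1 N) => hsum (latticePoint N z k)).mul_left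
      (1 / (N : ℂ))
    refine h1.congr_fun fun h => ?_
    rw [← latticeAverage_mFourier hN]
    simp_rw [smul_eq_mul, ← Finset.mul_sum]
    ring
  have hzero : HasSum (fun h => c h * if h = 0 then 1 else 0) (periodIntegral f) := by
    rw [periodIntegral_eq]
    convert! hasSum_ite_eq (0 : Fin s → ℤ) (c 0) using 2 with h
    by_cases hh : h = 0 <;> simp [hh]
  have herr := hrule.sub hzero
  have hind : ∀ h, (c h * (if h ∈ dualLattice N z then 1 else 0) - c h * if h = 0 then 1 else 0) =
      ({h | h ≠ 0} ∩ dualLattice N z).indicator c h := by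
    intro h
    by_cases h0 : h = 0
    · have : (0 : Fin s → ℤ) ∈ dualLattice N z := by simp [dualLattice]
      simp [h0, this]
    · by_cases hd : h ∈ dualLattice N z <;> simp [h0, hd]
  simp_rw [hind] at herr
  have hle : ‖periodIntegral f - latticeRule N z f‖ₑ ≤
      ∑' h : ↥({h | h ≠ 0} ∩ dualLattice N z), ‖c h‖ₑ := by
    rw [enorm_sub_rev, ← herr.tsum_eq, ← tsum_subtype]
    exact enorm_tsum_le_tsum_enorm
  calc _ ≤ (∑' h : ↥({h | h ≠ 0} ∩ dualLattice N z), ‖c h‖ₑ) ^ 2 := by gcongr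
    _ ≤ _ := tsum_sq_le_of_sq_le_mul _ _ _ fun h => hterm h
    _ ≤ dualSum α γ N z {h | h ≠ 0} * 1 := by
        rw [dualSum]
        gcongr
        exact (ENNReal.tsum_comp_le_tsum_of_injective Subtype.val_injective
          fun h => (freqWeight α γ h)⁻¹ * ‖c h‖ₑ ^ 2).trans hf
    _ = _ := mul_one _

lemma sum_freqWeight_le_korobovError_sq (α : ℝ) (γ : Finset (Fin s) → ℝ) {N : ℕ} (hN : 0 < N)
    (z : Fin s → ℕ) (S : Finset (Fin s → ℤ)) (hS : ↑S ⊆ {h | h ≠ 0} ∩ dualLattice N z) :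
    ∑ h ∈ S, freqWeight α γ h ≤ korobovError α γ N z ^ 2 := by
  classical
  set r : (Fin s → ℤ) → ℝ := fun h => (freqWeight α γ h).toReal with hr
  have hrof : ∀ h, freqWeight α γ h = ENNReal.ofReal (r h) := fun h =>
    (ENNReal.ofReal_toReal (freqWeight_ne_top _ _ _)).symm
  have hr0 : ∀ h, 0 ≤ r h := fun h => ENNReal.toReal_nonneg
  set R := ∑ h ∈ S, r h with hR
  have hR0 : 0 ≤ R := Finset.sum_nonneg fun h _ => hr0 h
  have hsumR : ∑ h ∈ S, freqWeight α γ h = ENNReal.ofReal R := by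
    simp_rw [hrof]
    rw [ENNReal.ofReal_sum_of_nonneg fun h _ => hr0 h]
  rw [hsumR]
  rcases hR0.eq_or_lt with h0 | hpos
  · simp [← h0]
  have hsq : 0 < Real.sqrt R := Real.sqrt_pos.2 hpos
  -- The equality case of Cauchy-Schwarz: coefficients proportional to the weights, scaled by `√R`
  -- to norm at most 1. The rule then returns `√R`, while the integral is 0.
  set f : C(UnitAddTorus (Fin s), ℂ) := ∑ h ∈ S, ((r h / Real.sqrt R : ℝ) : ℂ) • mFourier h with hf
  have hcoef : ∀ n, mFourierCoeff f n = if n ∈ S then ((r n / Real.sqrt R : ℝ) : ℂ) else 0 := by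
    intro n
    rw [hf, mFourierCoeff_sum]
    simp_rw [mFourierCoeff_mFourier]
    simp
  have hnorm : korobovNormSq α γ f ≤ 1 := by
    rw [korobovNormSq_eq, tsum_eq_sum (s := S)]
    · calc _ ≤ ∑ h ∈ S, ENNReal.ofReal (r h / R) := by
            refine Finset.sum_le_sum fun h hh => ?_
            rw [hcoef, if_pos hh, ← ofReal_norm, Complex.norm_real, Real.norm_of_nonneg
              (div_nonneg (hr0 h) hsq.le), ← ENNReal.ofReal_pow (div_nonneg (hr0 h) hsq.le), hrof,
              div_pow, Real.sq_sqrt hR0]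
            rcases (hr0 h).eq_or_lt with h0 | h0
            · simp [← h0]
            · rw [← ENNReal.ofReal_inv_of_pos h0, ← ENNReal.ofReal_mul (by positivity)]
              apply le_of_eq
              congr 1
              field_simp
        _ = ENNReal.ofReal (∑ h ∈ S, r h / R) :=
            (ENNReal.ofReal_sum_of_nonneg fun h _ => div_nonneg (hr0 h) hR0).symm
        _ = 1 := by rw [← Finset.sum_div, ← hR, div_self hpos.ne', ENNReal.ofReal_one]
    · intro h hh
      rw [hcoef, if_neg hh]; simp
  have hper : periodIntegral f = 0 := by
    rw [periodIntegral_eq, hcoef, if_neg]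
    intro h; exact (hS h).1 rfl
  have hrule : latticeRule N z f = (Real.sqrt R : ℂ) := by
    rw [latticeRule_eq]
    simp only [hf, ContinuousMap.coe_sum, Finset.sum_apply, ContinuousMap.coe_smul, Pi.smul_apply,
      smul_eq_mul]
    rw [Finset.sum_comm, Finset.mul_sum]
    have : ∀ h ∈ S, (1 / (N : ℂ)) * ∑ k ∈ Finset.Icc 1 N, ((r h / Real.sqrt R : ℝ) : ℂ) *
        mFourier h (latticePoint N z k) = ((r h / Real.sqrt R : ℝ) : ℂ) := by
      intro h hh
      rw [← Finset.mul_sum, mul_left_comm, latticeAverage_mFourier hN, if_pos (hS hh).2, mul_one]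
    rw [Finset.sum_congr rfl this, ← Complex.ofReal_sum, ← Finset.sum_div, ← hR, Real.div_sqrt]
  have hle : ‖periodIntegral f - latticeRule N z f‖ₑ ≤ korobovError α γ N z :=
    le_iSup₂_of_le f hnorm le_rfl
  rw [hper, hrule, zero_sub, enorm_neg, ← ofReal_norm, Complex.norm_real,
    Real.norm_of_nonneg hsq.le] at hle
  calc ENNReal.ofReal R = ENNReal.ofReal (Real.sqrt R) ^ 2 := by
        rw [← ENNReal.ofReal_pow hsq.le, Real.sq_sqrt hR0]
    _ ≤ _ := by gcongr

/-- The squared worst-case error in the Korobov space is a sum over the dual lattice. -/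
theorem korobovError_sq {α : ℝ} (hα : 1 < α) (γ : Finset (Fin s) → ℝ) {N : ℕ} (hN : 0 < N)
    (z : Fin s → ℕ) : korobovError α γ N z ^ 2 = dualSum α γ N z {h | h ≠ 0} := by
  refine le_antisymm (korobovError_sq_le hα γ hN z) ?_
  rw [dualSum, ENNReal.tsum_eq_iSup_sum]
  refine iSup_le fun S => ?_
  have := sum_freqWeight_le_korobovError_sq α γ hN z (S.map (Function.Embedding.subtype _)) (by
    intro h hh
    simp only [Finset.coe_map, Set.mem_image] at hh
    obtain ⟨x, _, rfl⟩ := hh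
    exact x.2)
  rwa [Finset.sum_map] at this

/-- The error of the first `d + 1` components as a sum over frequencies in all components. -/
theorem prefixErrorSq_eq {α : ℝ} (hα : 1 < α) (γ : Finset (Fin s) → ℝ) {N : ℕ} (hN : 0 < N)
    (z : Fin s → ℕ) (d : Fin s) :
    prefixErrorSq α γ N z d = dualSum α γ N z (prefixFreq s (d.val + 1)) := by
  rw [prefixErrorSq, korobovError_sq hα _ hN]
  set ι : Fin (d.val + 1) ↪ Fin s := Fin.castLEEmb d.isLt with hι
  -- Extension by zero identifies the frequencies in the first `d + 1` components with vectors of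
  -- length `s`, preserving supports, weights and the dual lattice.
  set ext : (Fin (d.val + 1) → ℤ) → Fin s → ℤ := fun h => Function.extend ι h 0 with hext
  have hext1 : ∀ h i, ext h (ι i) = h i := fun h i => ι.injective.extend_apply _ _ _
  have hext2 : ∀ h j, (∀ i, ι i ≠ j) → ext h j = 0 := fun h j hj =>
    Function.extend_apply' _ _ _ (by rintro ⟨i, hi⟩; exact hj i hi)
  have hlt : ∀ j : Fin s, (∃ i, ι i = j) ↔ j.val < d.val + 1 := by
    intro j
    constructor
    · rintro ⟨i, rfl⟩; exact i.isLt
    · intro hj; exact ⟨⟨j.val, hj⟩, rfl⟩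
  have hsupp : ∀ h, freqSupport (ext h) = (freqSupport h).map ι := by
    intro h
    ext j
    rw [mem_freqSupport, Finset.mem_map]
    constructor
    · intro hj
      by_cases hi : ∃ i, ι i = j
      · obtain ⟨i, rfl⟩ := hi
        exact ⟨i, mem_freqSupport.2 (by rwa [hext1] at hj), rfl⟩
      · exact absurd (hext2 h j fun i hh => hi ⟨i, hh⟩) hj
    · rintro ⟨i, hi, rfl⟩
      rw [hext1]; exact mem_freqSupport.1 hi
  have hweight : ∀ h, freqWeight α (fun u => γ (u.map ι)) h = freqWeight α γ (ext h) := by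
    intro h
    rw [freqWeight, freqWeight, hsupp, Finset.prod_map]
    simp_rw [hext1]
  have hdot : ∀ h, ∑ j, ext h j * (z j : ℤ) = ∑ i, h i * (z (ι i) : ℤ) := by
    intro h
    rw [← Finset.sum_subset (Finset.subset_univ (Finset.univ.map ι)), Finset.sum_map]
    · simp_rw [hext1]
    · intro j _ hj
      rw [hext2 h j, zero_mul]
      rintro i rfl
      exact hj (Finset.mem_map_of_mem _ (Finset.mem_univ _))
  have hinj : Function.Injective ext := by
    intro h h' hh
    funext i
    rw [← hext1 h, ← hext1 h', hh]
  have himage : ext '' ({h | h ≠ 0} ∩ dualLattice N fun i => z (ι i)) =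
      prefixFreq s (d.val + 1) ∩ dualLattice N z := by
    ext h
    constructor
    · rintro ⟨g, ⟨hg0, hg1⟩, rfl⟩
      refine ⟨⟨fun h0 => hg0 ?_, fun j hj => hext2 _ _ fun i hi => ?_⟩, ?_⟩
      · funext i; rw [← hext1 g, h0]; rfl
      · exact absurd ((hlt j).1 ⟨i, hi⟩) (by omega)
      · rw [dualLattice, Set.mem_ofPred_eq, hdot]; exact hg1
    · rintro ⟨⟨h0, h1⟩, h2⟩
      have hh : ext (fun i => h (ι i)) = h := by
        funext j
        by_cases hi : ∃ i, ι i = j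
        · obtain ⟨i, rfl⟩ := hi; rw [hext1]
        · rw [hext2 _ j fun i hh => hi ⟨i, hh⟩, h1 j]
          rw [hlt] at hi; omega
      refine ⟨fun i => h (ι i), ⟨fun hz => h0 ?_, ?_⟩, hh⟩
      · rw [← hh, hz]
        funext j
        by_cases hi : ∃ i, ι i = j
        · obtain ⟨i, rfl⟩ := hi; rw [hext1]; rfl
        · exact hext2 _ j fun i hh => hi ⟨i, hh⟩
      · rw [dualLattice, Set.mem_ofPred_eq, ← hdot, hh]; exact h2
  rw [dualSum, dualSum, ← himage, tsum_image _ hinj.injOn]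
  exact tsum_congr fun h => hweight h

/-! ### The mean square error over the shift -/

lemma cubeMeasure_eq_pi (ι : Type*) [Fintype ι] :
    cubeMeasure ι = Measure.pi fun _ : ι => (volume : Measure ℝ).restrict (Set.Icc (-(1 / 2)) (1 / 2)) := by
  rw [cubeMeasure, cube, volume_pi, ← Set.pi_univ_Icc, Measure.restrict_pi_pi]

lemma measurePreserving_coe_circle (a : ℝ) :
    MeasurePreserving (fun t : ℝ => (t : UnitAddCircle)) (volume.restrict (Set.Icc a (a + 1)))
      volume := by
  rw [← restrict_Ioc_eq_restrict_Icc]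
  convert! UnitAddCircle.measurePreserving_mk a using 1
  simp [volume, AddCircle.haarAddCircle]

/-- The coordinates in `[-1/2, 1/2)` of the points of the circle. -/
def circleSection (x : UnitAddCircle) : ℝ := AddCircle.equivIco (1 : ℝ) 0 x - 1 / 2

lemma circleSection_coe (t : ℝ) : circleSection (t : UnitAddCircle) = Int.fract t - 1 / 2 := by
  rw [circleSection, AddCircle.coe_equivIco_mk_apply]; simp

lemma coe_circleSection (x : UnitAddCircle) :
    ((circleSection x + 1 / 2 : ℝ) : UnitAddCircle) = x := by
  rw [circleSection, sub_add_cancel]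
  exact (AddCircle.equivIco (1 : ℝ) 0).symm_apply_apply x

lemma measurePreserving_circleSection :
    MeasurePreserving circleSection volume
      ((volume : Measure ℝ).restrict (Set.Icc (-(1 / 2)) (1 / 2))) := by
  have hmeas : Measurable circleSection :=
    (measurable_subtype_coe.comp (AddCircle.measurableEquivIco (1 : ℝ) 0).measurable).sub_const _
  refine ⟨hmeas, ?_⟩
  have h1 := measurePreserving_coe_circle 0
  rw [← h1.map_eq, Measure.map_map hmeas h1.measurable, zero_add]
  have h2 : (circleSection ∘ fun t : ℝ => (t : UnitAddCircle)) =ᵐ[volume.restrict (Set.Icc 0 1)]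
      fun t => t - 1 / 2 := by
    rw [← restrict_Ico_eq_restrict_Icc]
    filter_upwards [ae_restrict_mem measurableSet_Ico] with t ht
    rw [Function.comp_apply, circleSection_coe, Int.fract_eq_self.2 ht]
  rw [Measure.map_congr h2]
  have h3 : MeasurePreserving (fun t : ℝ => t - 1 / 2) volume volume :=
    measurePreserving_sub_right volume _
  have h4 := h3.restrict_preimage (s := Set.Icc (-(1 / 2) : ℝ) (1 / 2)) measurableSet_Icc
  have h5 : (fun t : ℝ => t - 1 / 2) ⁻¹' Set.Icc (-(1 / 2) : ℝ) (1 / 2) = Set.Icc 0 1 := by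
    ext t; simp only [Set.mem_preimage, Set.mem_Icc]; constructor <;> rintro ⟨h, h'⟩ <;>
      constructor <;> linarith
  rw [h5] at h4
  exact h4.map_eq

/-- The coordinates in `[-1/2, 1/2)^s` of the points of the torus. -/
def torusSection (x : UnitAddTorus (Fin s)) : Fin s → ℝ := fun j => circleSection (x j)

lemma measurePreserving_torusSection :
    MeasurePreserving (torusSection (s := s)) volume (cubeMeasure (Fin s)) := by
  rw [cubeMeasure_eq_pi]
  exact measurePreserving_pi _ _ fun _ => measurePreserving_circleSection

lemma measurePreserving_coe_torus :
    MeasurePreserving (fun (t : Fin s → ℝ) j => (t j : UnitAddCircle))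
      (volume.restrict (Set.Icc (0 : Fin s → ℝ) 1)) volume := by
  have h1 : (volume : Measure (Fin s → ℝ)).restrict (Set.Icc (0 : Fin s → ℝ) 1) =
      Measure.pi fun _ => volume.restrict (Set.Icc (0 : ℝ) (0 + 1)) := by
    rw [volume_pi, ← Set.pi_univ_Icc, Measure.restrict_pi_pi]; simp
  rw [h1]
  exact measurePreserving_pi _ _ fun _ => measurePreserving_coe_circle 0

/-- The exponential `t ↦ exp(-2πin(t + 1/2))`. -/
def shiftedExp (n : ℤ) (t : ℝ) : ℂ := fourier (-n) ((t + 1 / 2 : ℝ) : UnitAddCircle)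

lemma continuous_shiftedExp (n : ℤ) : Continuous (shiftedExp n) :=
  (fourier (-n)).continuous.comp ((AddCircle.continuous_mk' 1).comp (by fun_prop))

/-- The Fourier coefficients, up to sign, of the periodic extension of `F`. -/
def cubeFourierCoeff (F : (Fin s → ℝ) → ℝ) (h : Fin s → ℤ) : ℂ :=
  ∫ y, (∏ j, shiftedExp (h j) (y j)) * (F y : ℂ) ∂(cubeMeasure (Fin s))

lemma mFourierCoeff_comp_torusSection {F : (Fin s → ℝ) → ℝ}
    (hF : AEStronglyMeasurable F (cubeMeasure (Fin s))) (h : Fin s → ℤ) :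
    mFourierCoeff (fun x : UnitAddTorus (Fin s) => (F (torusSection x) : ℂ)) h =
      cubeFourierCoeff F h := by
  have hcont : Continuous fun y : Fin s → ℝ => ∏ j, shiftedExp (h j) (y j) :=
    continuous_finsetProd _ fun j _ => (continuous_shiftedExp _).comp (continuous_apply j)
  rw [cubeFourierCoeff, ← measurePreserving_torusSection.map_eq,
    integral_map measurePreserving_torusSection.aemeasurable, mFourierCoeff]
  · refine integral_congr_ae (Filter.Eventually.of_forall fun x => ?_)
    simp only [mFourier, ContinuousMap.coe_mk, smul_eq_mul, shiftedExp, torusSection,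
      coe_circleSection, Pi.neg_apply]
  · rw [measurePreserving_torusSection.map_eq]
    exact hcont.aestronglyMeasurable.mul (Complex.continuous_ofReal.comp_aestronglyMeasurable hF)

lemma mFourierCoeff_translate (f : UnitAddTorus (Fin s) → ℂ) (p : UnitAddTorus (Fin s))
    (h : Fin s → ℤ) :
    mFourierCoeff (fun x => f (x + p)) h = mFourier h p * mFourierCoeff f h := by
  have h1 : ∀ x : UnitAddTorus (Fin s), mFourier (-h) x • f (x + p) =
      mFourier h p * (mFourier (-h) (x + p) • f (x + p)) := by
    intro x
    have h2 : mFourier (-h) (x + p) = mFourier (-h) x * mFourier (-h) p := by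
      simp only [mFourier, ContinuousMap.coe_mk, ← Finset.prod_mul_distrib, Pi.add_apply]
      refine Finset.prod_congr rfl fun j _ => ?_
      rw [fourier_apply, fourier_apply, fourier_apply, smul_add, AddCircle.toCircle_add]
      push_cast; rfl
    have h3 : mFourier h p * mFourier (-h) p = 1 := by
      rw [← mFourier_add, add_neg_cancel, mFourier_zero, ContinuousMap.one_apply]
    rw [h2, smul_eq_mul, smul_eq_mul]
    linear_combination (-(mFourier (-h) x * f (x + p))) * h3
  unfold mFourierCoeff
  simp_rw [h1]
  rw [integral_const_mul, integral_add_right_eq_self (fun x => mFourier (-h) x • f x)]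

/-- Parseval's identity for the error of the randomly shifted lattice rule. -/
theorem integral_sqError {F : (Fin s → ℝ) → ℝ} (hF : MemLp F 2 (cubeMeasure (Fin s))) {N : ℕ}
    (hN : 0 < N) (z : Fin s → ℕ) :
    IntegrableOn (sqError N z F) (Set.Icc (0 : Fin s → ℝ) 1) ∧
      ENNReal.ofReal (∫ Δ in Set.Icc (0 : Fin s → ℝ) 1, sqError N z F Δ) =
        ∑' h : ↥({h | h ≠ 0} ∩ dualLattice N z), ‖cubeFourierCoeff F h‖ₑ ^ 2 := by
  classical
  set f : UnitAddTorus (Fin s) → ℂ := fun x => (F (torusSection x) : ℂ) with hf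
  have hf2 : MemLp f 2 := by
    have h1 : MemLp (fun y => (F y : ℂ)) 2 (cubeMeasure (Fin s)) := hF.ofReal
    exact h1.comp_measurePreserving measurePreserving_torusSection
  set I : ℂ := (cubeIntegral F : ℂ) with hI
  have hfk : ∀ k, MemLp (fun x => f (x + latticePoint N z k)) 2 := fun k =>
    hf2.comp_measurePreserving (measurePreserving_add_right volume _)
  -- Up to sign, the error as a function of the shift: an average of translates of `f`, minus a
  -- constant.
  set G : UnitAddTorus (Fin s) → ℂ :=
    fun x => (1 / (N : ℂ)) * ∑ k ∈ Finset.Icc 1 N, f (x + latticePoint N z k) - I with hG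
  have hsum2 : MemLp (fun x => ∑ k ∈ Finset.Icc 1 N, f (x + latticePoint N z k)) 2 :=
    memLp_finsetSum _ fun k _ => hfk k
  have hG2 : MemLp G 2 := (hsum2.const_mul _).sub (memLp_const I)
  have hsq : ∀ Δ : Fin s → ℝ, sqError N z F Δ = ‖G fun j => (Δ j : UnitAddCircle)‖ ^ 2 := by
    intro Δ
    have h1 : G (fun j => (Δ j : UnitAddCircle)) =
        ((shiftedLatticeRule N z Δ F - cubeIntegral F : ℝ) : ℂ) := by
      simp only [hG, hI, shiftedLatticeRule, hf]
      push_cast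
      congr 3
      funext k
      congr 2
      funext j
      rw [torusSection, Pi.add_apply, latticePoint, ← AddCircle.coe_add, circleSection_coe,
        add_comm]
    rw [h1, Complex.norm_real, Real.norm_eq_abs, abs_sub_comm, sqError]
  have hGint : Integrable fun x => ‖G x‖ ^ 2 := by
    have := hG2.integrable_norm_rpow (by norm_num) (by norm_num)
    simpa using this
  have hfun : sqError N z F = (fun x => ‖G x‖ ^ 2) ∘ fun (t : Fin s → ℝ) j => (t j : UnitAddCircle) :=
    funext hsq
  have hmp := measurePreserving_coe_torus (s := s)
  constructor
  · rw [hfun, IntegrableOn]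
    exact hmp.integrable_comp_of_integrable hGint
  have hint : ∫ Δ in Set.Icc (0 : Fin s → ℝ) 1, sqError N z F Δ = ∫ x, ‖G x‖ ^ 2 := by
    rw [integral_torus_eq _ 0, zero_add]
    simp_rw [hsq]
  have hcoefG : ∀ h, mFourierCoeff G h =
      ({h | h ≠ 0} ∩ dualLattice N z).indicator (cubeFourierCoeff F) h := by
    intro h
    have hconst : mFourierCoeff (fun _ : UnitAddTorus (Fin s) => I) h = if h = 0 then I else 0 := by
      have h1 := mFourierCoeff_mFourier (0 : Fin s → ℤ) h
      unfold mFourierCoeff at h1 ⊢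
      simp only [mFourier_zero, ContinuousMap.one_apply, smul_eq_mul, mul_one] at h1 ⊢
      rw [integral_mul_const, h1]
      simp
    have hexp : ∀ g : UnitAddTorus (Fin s) → ℂ, MemLp g 2 →
        Integrable fun x => mFourier (-h) x • g x := by
      intro g hg
      refine (hg.integrable (by norm_num)).bdd_mul
        (mFourier (-h)).continuous.aestronglyMeasurable (c := 1) ?_
      exact Filter.Eventually.of_forall fun x =>
        ((mFourier (-h)).norm_coe_le_norm x).trans mFourier_norm.le
    have h1 : mFourierCoeff G h = (1 / (N : ℂ)) * ∑ k ∈ Finset.Icc 1 N,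
        mFourierCoeff (fun x => f (x + latticePoint N z k)) h -
          mFourierCoeff (fun _ : UnitAddTorus (Fin s) => I) h := by
      unfold mFourierCoeff
      rw [← integral_finsetSum _ fun k _ => hexp _ (hfk k), ← integral_const_mul,
        ← integral_sub ((integrable_finsetSum _ fun k _ => hexp _ (hfk k)).const_mul _)
          (hexp _ (memLp_const I))]
      refine integral_congr_ae (Filter.Eventually.of_forall fun x => ?_)
      simp only [hG, smul_eq_mul, Finset.mul_sum, mul_sub]
      congr 1
      exact Finset.sum_congr rfl fun k _ => by ring
    rw [h1]
    simp_rw [mFourierCoeff_translate]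
    rw [← Finset.sum_mul, ← mul_assoc, latticeAverage_mFourier hN, hconst, hf,
      mFourierCoeff_comp_torusSection hF.aestronglyMeasurable]
    by_cases h0 : h = 0
    · have hmem : (0 : Fin s → ℤ) ∈ dualLattice N z := by simp [dualLattice]
      have hc0 : cubeFourierCoeff F 0 = I := by
        simp only [cubeFourierCoeff, shiftedExp, Pi.zero_apply, neg_zero, fourier_zero,
          Finset.prod_const_one, one_mul]
        rw [hI, cubeIntegral, ← integral_complex_ofReal]
      simp [h0, hmem, hc0]
    · by_cases hd : h ∈ dualLattice N z <;> simp [h0, hd]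
  have hpars := hasSum_sq_mFourierCoeff (hG2.toLp G)
  have hcongr : ∀ h, mFourierCoeff (hG2.toLp G) h = mFourierCoeff G h := by
    intro h
    refine integral_congr_ae ?_
    filter_upwards [hG2.coeFn_toLp] with x hx
    rw [hx]
  have hcongr2 : ∫ x, ‖(hG2.toLp G) x‖ ^ 2 = ∫ x, ‖G x‖ ^ 2 := by
    refine integral_congr_ae ?_
    filter_upwards [hG2.coeFn_toLp] with x hx
    rw [hx]
  rw [hcongr2] at hpars
  simp_rw [hcongr, hcoefG] at hpars
  rw [hint, ← hpars.tsum_eq, ENNReal.ofReal_tsum_of_nonneg (fun h => by positivity) hpars.summable,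
    tsum_subtype ({h | h ≠ 0} ∩ dualLattice N z) fun h => ‖cubeFourierCoeff F h‖ₑ ^ 2]
  refine tsum_congr fun h => ?_
  rw [ENNReal.ofReal_pow (norm_nonneg _), ofReal_norm]
  by_cases hm : h ∈ {h | h ≠ 0} ∩ dualLattice N z
  · rw [Set.indicator_of_mem hm, Set.indicator_of_mem hm]
  · rw [Set.indicator_of_notMem hm, Set.indicator_of_notMem hm]; simp

end Torus

/-! ### Approximation by test functions in one variable -/

open Filter Topology

open Classical in
/-- `A` is a bounded pointwise limit on `(-1/2, 1/2)` of test functions; so is `a`, of the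
derivatives of these functions if `d` holds, and of the functions themselves otherwise. -/
def HasTestApprox (d : Prop) (a A : ℝ → ℝ) : Prop :=
  ∃ φ : ℕ → ℝ → ℝ, (∀ n, ContDiff ℝ ∞ (φ n)) ∧
    (∀ n, tsupport (φ n) ⊆ Set.Ioo (-(1 / 2)) (1 / 2)) ∧
    (∃ C, ∀ n t, |φ n t| ≤ C ∧ |(if d then deriv (φ n) else φ n) t| ≤ C) ∧
    ∀ t ∈ Set.Ioo (-(1 / 2) : ℝ) (1 / 2), Tendsto (fun n => φ n t) atTop (𝓝 (A t)) ∧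
      Tendsto (fun n => (if d then deriv (φ n) else φ n) t) atTop (𝓝 (a t))

/-- A smooth cutoff function supported in the open interval `(-1/2, 1/2)`. -/
def cutoff (n : ℕ) : ContDiffBump (0 : ℝ) where
  -- The offset 5 keeps this radius positive already at `n = 0`, where it equals `1 / 10`.
  rIn := 1 / 2 - 2 / (n + 5)
  rOut := 1 / 2 - 1 / (n + 5)
  rIn_pos := by
    have : (2 : ℝ) / (n + 5) < 1 / 2 := by
      rw [div_lt_div_iff₀ (by positivity) (by norm_num)]
      have : (0 : ℝ) ≤ n := n.cast_nonneg
      linarith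
    linarith
  rIn_lt_rOut := by
    have : (1 : ℝ) / (n + 5) < 2 / (n + 5) := by gcongr; norm_num
    linarith

lemma cutoff_rOut (n : ℕ) : (cutoff n).rOut = 1 / 2 - 1 / (n + 5) := rfl

lemma cutoff_rIn (n : ℕ) : (cutoff n).rIn = 1 / 2 - 2 / (n + 5) := rfl

lemma cutoff_rOut_lt (n : ℕ) : (cutoff n).rOut < 1 / 2 := by
  rw [cutoff_rOut]
  have : (0 : ℝ) < 1 / (n + 5) := by positivity
  linarith

lemma cutoff_rOut_mono (n : ℕ) : (cutoff 0).rOut ≤ (cutoff n).rOut := by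
  rw [cutoff_rOut, cutoff_rOut]
  have : (1 : ℝ) / (n + 5) ≤ 1 / ((0 : ℕ) + 5) := by gcongr; simp
  linarith

lemma cutoff_eq_zero {n : ℕ} {t : ℝ} (ht : (cutoff n).rOut ≤ |t|) : cutoff n t = 0 :=
  (cutoff n).zero_of_le_dist (by simpa using ht)

lemma tendsto_cutoff {t : ℝ} (ht : t ∈ Set.Ioo (-(1 / 2) : ℝ) (1 / 2)) :
    Tendsto (fun n => cutoff n t) atTop (𝓝 1) := by
  have h1 : |t| < 1 / 2 := abs_lt.2 ht
  have h2 : Tendsto (fun n : ℕ => (1 : ℝ) / 2 - 2 / (n + 5)) atTop (𝓝 (1 / 2 - 0)) := by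
    refine tendsto_const_nhds.sub (Tendsto.div_atTop tendsto_const_nhds ?_)
    exact tendsto_atTop_add_const_right _ _ tendsto_natCast_atTop_atTop
  rw [sub_zero] at h2
  refine tendsto_const_nhds.congr' ?_
  filter_upwards [h2.eventually (lt_mem_nhds h1)] with n hn
  exact ((cutoff n).one_of_mem_closedBall (by simpa [cutoff_rIn] using hn.le)).symm

lemma Icc_cutoff_subset (n : ℕ) :
    Set.Icc (-(cutoff n).rOut) (cutoff n).rOut ⊆ Set.Ioo (-(1 / 2) : ℝ) (1 / 2) := by
  intro t ht
  have := cutoff_rOut_lt n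
  exact ⟨by linarith [ht.1], by linarith [ht.2]⟩

lemma tsupport_subset_of_eq_zero {φ : ℝ → ℝ} {ρ : ℝ} (h : ∀ t, ρ < |t| → φ t = 0) :
    tsupport φ ⊆ Set.Icc (-ρ) ρ := by
  refine closure_minimal (fun t ht => ?_) isClosed_Icc
  rw [Set.mem_Icc, ← abs_le]
  by_contra hlt
  exact ht (h t (not_le.1 hlt))

lemma hasTestApprox_false {a : ℝ → ℝ} (ha : ContDiff ℝ ∞ a) {C : ℝ} (hC : ∀ t, |a t| ≤ C)
    {d : Prop} (hd : ¬ d) : HasTestApprox d a a := by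
  have hlim : ∀ t ∈ Set.Ioo (-(1 / 2) : ℝ) (1 / 2),
      Tendsto (fun n => cutoff n t * a t) atTop (𝓝 (a t)) := by
    intro t ht
    simpa using (tendsto_cutoff ht).mul_const (a t)
  have hbd : ∀ (n : ℕ) t, |cutoff n t * a t| ≤ C := by
    intro n t
    rw [abs_mul, abs_of_nonneg (cutoff n).nonneg]
    calc cutoff n t * |a t| ≤ 1 * C :=
          mul_le_mul (cutoff n).le_one (hC t) (abs_nonneg _) zero_le_one
      _ = C := one_mul C
  refine ⟨fun n t => cutoff n t * a t, fun n => (cutoff n).contDiff.mul ha, fun n => ?_,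
    ⟨C, fun n t => ⟨hbd n t, ?_⟩⟩, fun t ht => ⟨hlim t ht, ?_⟩⟩
  · refine (tsupport_subset_of_eq_zero fun t ht => ?_).trans (Icc_cutoff_subset n)
    simp only [cutoff_eq_zero ht.le, zero_mul]
  · rw [if_neg hd]; exact hbd n t
  · simpa only [if_neg hd] using hlim t ht

/-- Integrating a cut-off copy of `a` gives a test function only if its mean vanishes, which the
cutoff destroys. A multiple of a fixed bump `η` of integral 1 restores it; the multiple `c n` tends
to `∫ a = A (1 / 2) - A (-(1 / 2)) = 0`, so the correction disappears in the limit. -/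
lemma hasTestApprox_true {a A : ℝ → ℝ} (ha : ContDiff ℝ ∞ a) {C : ℝ} (hC : ∀ t, |a t| ≤ C)
    (hA : ∀ t, HasDerivAt A (a t) t) (hA0 : A (-(1 / 2)) = 0) (hA1 : A (1 / 2) = 0)
    {d : Prop} (hd : d) : HasTestApprox d a A := by
  have hac : Continuous a := ha.continuous
  have hC0 : 0 ≤ C := (abs_nonneg _).trans (hC 0)
  have hFTC : ∀ t, ∫ x in (-(1 / 2))..t, a x = A t := by
    intro t
    rw [intervalIntegral.integral_eq_sub_of_hasDerivAt (fun x _ => hA x)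
      (hac.intervalIntegrable _ _), hA0, sub_zero]
  set η : ℝ → ℝ := (cutoff 0).normed volume with hη
  have hηc : Continuous η := (cutoff 0).continuous_normed
  obtain ⟨E, hE⟩ : ∃ E, ∀ t, |η t| ≤ E := by
    obtain ⟨E, hE⟩ := (cutoff 0).hasCompactSupport_normed.exists_bound_of_continuous hηc
    exact ⟨E, hE⟩
  have hη0 : ∀ t, (cutoff 0).rOut ≤ |t| → η t = 0 := by
    intro t ht
    rw [hη, (cutoff 0).normed_def, cutoff_eq_zero ht, zero_div]
  have hηint : ∫ x in (-(1 / 2) : ℝ)..(1 / 2), η x = 1 := by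
    rw [intervalIntegral.integral_of_le (by norm_num)]
    refine Eq.trans ?_ ((cutoff 0).integral_normed (μ := volume))
    refine setIntegral_eq_integral_of_forall_compl_eq_zero fun t ht => hη0 t ?_
    by_contra hlt
    have h1 := abs_lt.1 ((not_le.1 hlt).trans (cutoff_rOut_lt 0))
    exact ht ⟨h1.1, h1.2.le⟩
  set c : ℕ → ℝ := fun n => ∫ x in (-(1 / 2) : ℝ)..(1 / 2), cutoff n x * a x with hc
  have hcut : ∀ n t, |cutoff n t * a t| ≤ C := by
    intro n t
    rw [abs_mul, abs_of_nonneg (cutoff n).nonneg]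
    calc cutoff n t * |a t| ≤ 1 * C :=
          mul_le_mul (cutoff n).le_one (hC t) (abs_nonneg _) zero_le_one
      _ = C := one_mul C
  have hcutc : ∀ n, Continuous fun t => cutoff n t * a t := fun n =>
    (cutoff n).continuous.mul hac
  have hclim : Tendsto c atTop (𝓝 0) := by
    rw [← hA1, ← hFTC (1 / 2)]
    refine intervalIntegral.tendsto_integral_filter_of_dominated_convergence (fun _ => C)
      (Eventually.of_forall fun n => (hcutc n).aestronglyMeasurable)
      (Eventually.of_forall fun n => Eventually.of_forall fun t _ => hcut n t)
      intervalIntegrable_const ?_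
    have hne : ∀ᵐ t : ℝ, t ≠ 1 / 2 := by simp [ae_iff]
    filter_upwards [hne] with t ht1 ht
    rw [Set.uIoc_of_le (by norm_num)] at ht
    simpa using (tendsto_cutoff ⟨ht.1, lt_of_le_of_ne ht.2 ht1⟩).mul_const (a t)
  have hcbd : ∀ n, |c n| ≤ C := by
    intro n
    have := intervalIntegral.norm_integral_le_of_norm_le_const (a := (-(1 / 2) : ℝ)) (b := 1 / 2)
      (f := fun x => cutoff n x * a x) (C := C) fun t _ => hcut n t
    norm_num at this
    exact this
  set e : ℕ → ℝ → ℝ := fun n t => cutoff n t * a t - c n * η t with he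
  have hesm : ∀ n, ContDiff ℝ ∞ (e n) := fun n =>
    ((cutoff n).contDiff.mul ha).sub (contDiff_const.mul (cutoff 0).contDiff_normed)
  have hec : ∀ n, Continuous (e n) := fun n => (hesm n).continuous
  have hebd : ∀ n t, |e n t| ≤ C + C * E := by
    intro n t
    refine (abs_sub _ _).trans (add_le_add (hcut n t) ?_)
    rw [abs_mul]
    exact mul_le_mul (hcbd n) (hE t) (abs_nonneg _) hC0
  have he0 : ∀ n t, (cutoff n).rOut ≤ |t| → e n t = 0 := by
    intro n t ht
    simp only [he]
    rw [cutoff_eq_zero ht, hη0 t ((cutoff_rOut_mono n).trans ht)]; ring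
  have hemean : ∀ n, ∫ x in (-(1 / 2) : ℝ)..(1 / 2), e n x = 0 := by
    intro n
    simp only [he]
    rw [intervalIntegral.integral_sub ((hcutc n).intervalIntegrable _ _)
      ((hηc.const_mul _).intervalIntegrable _ _), intervalIntegral.integral_const_mul, hηint]
    simp [hc]
  have helim : ∀ t ∈ Set.Ioo (-(1 / 2) : ℝ) (1 / 2), Tendsto (fun n => e n t) atTop (𝓝 (a t)) := by
    intro t ht
    simpa using ((tendsto_cutoff ht).mul_const (a t)).sub (hclim.mul_const (η t))
  set φ : ℕ → ℝ → ℝ := fun n t => ∫ x in (-(1 / 2))..t, e n x with hφ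
  have hφd : ∀ n t, HasDerivAt (φ n) (e n t) t := fun n t =>
    intervalIntegral.integral_hasDerivAt_right ((hec n).intervalIntegrable _ _)
      (hec n).aestronglyMeasurable.stronglyMeasurableAtFilter (hec n).continuousAt
  have hφderiv : ∀ n, deriv (φ n) = e n := fun n => funext fun t => (hφd n t).deriv
  have hφ0 : ∀ n t, (cutoff n).rOut < |t| → φ n t = 0 := by
    intro n t ht
    have hr := cutoff_rOut_lt n
    have hr0 := (cutoff n).rOut_pos
    rcases lt_abs.1 ht with h | h
    · simp only [hφ]
      -- To the right of the support, the integral up to `1 / 2` is the vanishing mean of `e n`, and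
      -- the rest is zero.
      rw [← intervalIntegral.integral_add_adjacent_intervals (b := 1 / 2)
        ((hec n).intervalIntegrable _ _) ((hec n).intervalIntegrable _ _), hemean, zero_add]
      refine (intervalIntegral.integral_congr (g := fun _ => 0) fun x hx => he0 n x ?_).trans
        (by simp)
      refine le_trans ?_ (le_abs_self x)
      exact (le_min hr.le h.le).trans hx.1
    · simp only [hφ]
      refine (intervalIntegral.integral_congr (g := fun _ => 0) fun x hx => he0 n x ?_).trans
        (by simp)
      refine le_trans ?_ (neg_le_abs x)
      have := hx.2.trans (max_le (by linarith : -(1 / 2) ≤ -(cutoff n).rOut) (by linarith))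
      linarith
  have hφbd : ∀ n t, |φ n t| ≤ C + C * E := by
    intro n t
    have hE0 : 0 ≤ E := (abs_nonneg _).trans (hE 0)
    by_cases ht : (cutoff n).rOut < |t|
    · rw [hφ0 n t ht, abs_zero]; positivity
    · have := intervalIntegral.norm_integral_le_of_norm_le_const (a := (-(1 / 2) : ℝ)) (b := t)
        (f := e n) (C := C + C * E) fun t _ => hebd n t
      refine this.trans (mul_le_of_le_one_right (by positivity) ?_)
      have h1 := abs_le.1 ((not_lt.1 ht).trans (cutoff_rOut_lt n).le)
      rw [abs_le]
      constructor <;> linarith [h1.1, h1.2]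
  refine ⟨φ, fun n => ?_, fun n => ?_, ⟨C + C * E, fun n t => ⟨hφbd n t, ?_⟩⟩,
    fun t ht => ⟨?_, ?_⟩⟩
  · rw [contDiff_infty_iff_deriv]
    exact ⟨fun t => (hφd n t).differentiableAt, by rw [hφderiv]; exact hesm n⟩
  · exact (tsupport_subset_of_eq_zero (hφ0 n)).trans (Icc_cutoff_subset n)
  · rw [if_pos hd, hφderiv]; exact hebd n t
  · rw [← hFTC t]
    refine intervalIntegral.tendsto_integral_filter_of_dominated_convergence (fun _ => C + C * E)
      (Eventually.of_forall fun n => (hec n).aestronglyMeasurable)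
      (Eventually.of_forall fun n => Eventually.of_forall fun t _ => hebd n t)
      intervalIntegrable_const ?_
    refine Eventually.of_forall fun x hx => helim x ?_
    rw [Set.uIoc_of_le ht.1.le] at hx
    exact ⟨hx.1, hx.2.trans_lt ht.2⟩
  · simpa only [if_pos hd, hφderiv] using helim t ht

/-! ### Integration by parts against products -/

lemma lineDeriv_prod (ψ : Fin s → ℝ → ℝ) (i : Fin s) (y : Fin s → ℝ) :
    lineDeriv ℝ (fun y : Fin s → ℝ => ∏ j, ψ j (y j)) y (Pi.single i 1) =
      ∏ j, Function.update ψ i (deriv (ψ i)) j (y j) := by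
  rw [lineDeriv]
  have h1 : ∀ t : ℝ, ∏ j, ψ j ((y + t • Pi.single i 1 : Fin s → ℝ) j) =
      ψ i (y i + t) * ∏ j ∈ Finset.univ.erase i, ψ j (y j) := by
    intro t
    rw [← Finset.mul_prod_erase _ _ (Finset.mem_univ i)]
    congr 1
    · simp
    · refine Finset.prod_congr rfl fun j hj => ?_
      simp [Finset.ne_of_mem_erase hj]
  simp_rw [h1]
  rw [deriv_mul_const_field, deriv_comp_const_add, add_zero,
    ← Finset.mul_prod_erase _ _ (Finset.mem_univ i), Function.update_self]
  congr 1
  refine Finset.prod_congr rfl fun j hj => ?_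
  rw [Function.update_of_ne (Finset.ne_of_mem_erase hj)]

lemma foldr_lineDeriv_prod (l : List (Fin s)) (hl : l.Nodup) (φ : Fin s → ℝ → ℝ) :
    l.foldr (fun j g y => lineDeriv ℝ g y (Pi.single j 1)) (fun y : Fin s → ℝ => ∏ j, φ j (y j)) =
      fun y => ∏ j, (if j ∈ l then deriv (φ j) else φ j) (y j) := by
  induction l with
  | nil => simp
  | cons i l ih =>
    rw [List.nodup_cons] at hl
    rw [List.foldr_cons, ih hl.2]
    funext y
    rw [lineDeriv_prod (fun j => if j ∈ l then deriv (φ j) else φ j)]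
    refine Finset.prod_congr rfl fun j _ => ?_
    by_cases hji : j = i
    · subst hji; simp [hl.1]
    · rw [Function.update_of_ne hji]; simp [hji]

lemma mixedPartial_prod (u : Finset (Fin s)) (φ : Fin s → ℝ → ℝ) :
    mixedPartial u (fun y : Fin s → ℝ => ∏ j, φ j (y j)) =
      fun y => ∏ j, (if j ∈ u then deriv (φ j) else φ j) (y j) := by
  rw [mixedPartial, foldr_lineDeriv_prod _ (Finset.sort_nodup _ _)]
  simp

lemma ae_mem_openCube : ∀ᵐ y ∂(cubeMeasure (Fin s)), y ∈ openCube (Fin s) := by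
  have h : (openCube (Fin s) : Set (Fin s → ℝ)) =ᵐ[volume] cube (Fin s) := by
    have := Measure.univ_pi_Ioo_ae_eq_Icc (μ := fun _ : Fin s => (volume : Measure ℝ))
      (f := fun _ => -(1 / 2)) (g := fun _ => 1 / 2)
    rwa [← volume_pi] at this
  rw [cubeMeasure, ← Measure.restrict_congr_set h]
  exact ae_restrict_mem (MeasurableSet.univ_pi fun _ => measurableSet_Ioo)

instance (ι : Type*) [Fintype ι] : IsFiniteMeasure (cubeMeasure ι) :=
  ⟨by rw [cubeMeasure, Measure.restrict_apply_univ]; exact isCompact_Icc.measure_lt_top⟩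

lemma tendsto_integral_mul_prod {F : (Fin s → ℝ) → ℝ} (hF : Integrable F (cubeMeasure (Fin s)))
    (f : ℕ → Fin s → ℝ → ℝ) (a : Fin s → ℝ → ℝ) (hf : ∀ n j, Continuous (f n j)) (C : Fin s → ℝ)
    (hC : ∀ n j t, |f n j t| ≤ C j)
    (hlim : ∀ j, ∀ t ∈ Set.Ioo (-(1 / 2) : ℝ) (1 / 2), Tendsto (fun n => f n j t) atTop (𝓝 (a j t))) :
    Tendsto (fun n => ∫ y, F y * ∏ j, f n j (y j) ∂(cubeMeasure (Fin s))) atTop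
      (𝓝 (∫ y, F y * ∏ j, a j (y j) ∂(cubeMeasure (Fin s)))) := by
  refine tendsto_integral_of_dominated_convergence (fun y => ‖F y‖ * ∏ j, C j) (fun n => ?_)
    (hF.norm.mul_const _) (fun n => Eventually.of_forall fun y => ?_) ?_
  · exact hF.aestronglyMeasurable.mul (continuous_finsetProd _ fun j _ =>
      (hf n j).comp (continuous_apply j)).aestronglyMeasurable
  · rw [norm_mul, norm_prod]
    gcongr with j _
    exact hC n j (y j)
  · filter_upwards [ae_mem_openCube] with y hy
    exact tendsto_const_nhds.mul (tendsto_finsetProd _ fun j _ => hlim j _ (hy j (Set.mem_univ j)))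

/-- Products of one-variable test functions are admissible in the definition of the weak derivative,
and dominated convergence carries the identity to factors that need not have compact support in the
open interval. -/
lemma integral_weakMixedDeriv_mul_prod {F g : (Fin s → ℝ) → ℝ} {u : Finset (Fin s)}
    (hF : Integrable F (cubeMeasure (Fin s))) (hg : IsWeakMixedDeriv F u g) {a A : Fin s → ℝ → ℝ}
    (ha : ∀ j, HasTestApprox (j ∈ u) (a j) (A j)) :
    ∫ y, F y * ∏ j, a j (y j) ∂(cubeMeasure (Fin s)) =
      (-1) ^ u.card * ∫ y, g y * ∏ j, A j (y j) ∂(cubeMeasure (Fin s)) := by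
  choose φ hsm hsupp hC hlim using ha
  choose C hC using hC
  have hgint : Integrable g (cubeMeasure (Fin s)) := hg.1.integrable (by norm_num)
  have hcont : ∀ j n, Continuous (if j ∈ u then deriv (φ j n) else φ j n) := by
    intro j n
    split_ifs
    · exact (contDiff_infty_iff_deriv.1 (hsm j n)).2.continuous
    · exact (hsm j n).continuous
  have h1 := tendsto_integral_mul_prod hF
    (fun n j => if j ∈ u then deriv (φ j n) else φ j n) a (fun n j => hcont j n) C
    (fun n j t => by
      have := (hC j n t).2
      split_ifs at this ⊢ <;> exact this)
    (fun j t ht => by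
      have := (hlim j t ht).2
      split_ifs at this ⊢ <;> exact this)
  have h2 := (tendsto_integral_mul_prod hgint (fun n j => φ j n) A
    (fun n j => (hsm j n).continuous) C (fun n j t => (hC j n t).1)
    (fun j t ht => (hlim j t ht).1)).const_mul ((-1 : ℝ) ^ u.card)
  refine tendsto_nhds_unique h1 (h2.congr fun n => ?_)
  set Φ : (Fin s → ℝ) → ℝ := fun y => ∏ j, φ j n (y j) with hΦ
  have hts : tsupport Φ ⊆ Set.univ.pi fun j => tsupport (φ j n) := by
    refine closure_minimal (fun y hy j _ => subset_tsupport _ ?_)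
      (isClosed_set_pi fun j _ => isClosed_tsupport _)
    intro h0
    exact hy (Finset.prod_eq_zero (Finset.mem_univ j) h0)
  have hcomp : HasCompactSupport Φ := by
    refine (isCompact_univ_pi fun j => ?_).of_isClosed_subset (isClosed_tsupport _) hts
    exact isCompact_Icc.of_isClosed_subset (isClosed_tsupport _)
      ((hsupp j n).trans Set.Ioo_subset_Icc_self)
  have hΦsm : ContDiff ℝ ∞ Φ :=
    contDiff_prod fun j _ => (hsm j n).comp (contDiff_apply ℝ ℝ j)
  rw [← hg.2 Φ hΦsm hcomp (hts.trans (Set.pi_mono fun j _ => hsupp j n)), hΦ, mixedPartial_prod]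

/-! ### The Fourier coefficients of functions with weak mixed derivatives -/

lemma shiftedExp_eq (n : ℤ) (t : ℝ) :
    shiftedExp n t = Complex.exp (-(2 * Real.pi * Complex.I * n) * (t + 1 / 2)) := by
  rw [shiftedExp, fourier_coe_apply]
  congr 1
  push_cast
  ring

/-- The antiderivative of `shiftedExp n` vanishing at both end points of `[-1/2, 1/2]`. -/
def antiExp (n : ℤ) (t : ℝ) : ℂ := (shiftedExp n t - 1) / (-(2 * Real.pi * Complex.I * n))

lemma norm_shiftedExp (n : ℤ) (t : ℝ) : ‖shiftedExp n t‖ = 1 := by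
  rw [shiftedExp, fourier_apply]; exact Circle.norm_coe _

lemma shiftedExp_zero (t : ℝ) : shiftedExp 0 t = 1 := by simp [shiftedExp_eq]

lemma shiftedExp_neg_half (n : ℤ) : shiftedExp n (-(1 / 2)) = 1 := by
  rw [shiftedExp_eq]; simp

lemma shiftedExp_half (n : ℤ) : shiftedExp n (1 / 2) = 1 := by
  rw [shiftedExp_eq, Complex.exp_eq_one_iff]
  exact ⟨-n, by push_cast; ring⟩

lemma contDiff_shiftedExp (n : ℤ) : ContDiff ℝ ∞ (shiftedExp n) := by
  have : shiftedExp n = fun t : ℝ =>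
      Complex.exp (-(2 * Real.pi * Complex.I * n) * ((t : ℂ) + 1 / 2)) := funext (shiftedExp_eq n)
  rw [this]
  exact (contDiff_const.mul (Complex.ofRealCLM.contDiff.add contDiff_const)).cexp

lemma continuous_antiExp (n : ℤ) : Continuous (antiExp n) :=
  ((continuous_shiftedExp n).sub continuous_const).div_const _

lemma hasDerivAt_antiExp {n : ℤ} (hn : n ≠ 0) (t : ℝ) :
    HasDerivAt (antiExp n) (shiftedExp n t) t := by
  set c : ℂ := -(2 * Real.pi * Complex.I * n) with hc
  have hc0 : c ≠ 0 := neg_ne_zero.2 (mul_ne_zero Complex.two_pi_I_ne_zero (by exact_mod_cast hn))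
  have h1 : HasDerivAt (fun t : ℝ => Complex.exp (c * ((t : ℂ) + 1 / 2)))
      (Complex.exp (c * ((t : ℂ) + 1 / 2)) * (c * 1)) t :=
    (((Complex.ofRealCLM.hasDerivAt (x := t)).add_const (1 / 2 : ℂ)).const_mul c).cexp
  have h2 : antiExp n = fun t : ℝ => (Complex.exp (c * ((t : ℂ) + 1 / 2)) - 1) / c := by
    funext t; rw [antiExp, shiftedExp_eq]
  rw [h2, shiftedExp_eq, ← hc]
  convert! (h1.sub_const 1).div_const c using 1
  rw [mul_one, mul_div_cancel_right₀ _ hc0]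

/-- `L` stands for the real or the imaginary part, as test functions are real. Outside the support
of `h` the exponential is the constant 1 and is not integrated. -/
lemma hasTestApprox_shiftedExp {u : Finset (Fin s)} {h : Fin s → ℤ} (hu : freqSupport h = u)
    (L : ℂ →L[ℝ] ℝ) (hL : ∀ z, |L z| ≤ ‖z‖) (j : Fin s) :
    HasTestApprox (j ∈ u) (fun t => L (shiftedExp (h j) t))
      (fun t => L (if j ∈ u then antiExp (h j) t else 1)) := by
  have hsm : ContDiff ℝ ∞ fun t => L (shiftedExp (h j) t) := L.contDiff.comp (contDiff_shiftedExp _)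
  have hbd : ∀ t, |L (shiftedExp (h j) t)| ≤ 1 := fun t =>
    (hL _).trans (norm_shiftedExp _ _).le
  by_cases hj : j ∈ u
  · simp only [if_pos hj]
    have h0 : h j ≠ 0 := by rw [← hu] at hj; exact mem_freqSupport.1 hj
    refine hasTestApprox_true hsm hbd (fun t => ?_) ?_ ?_ hj
    · exact L.hasFDerivAt.comp_hasDerivAt t (hasDerivAt_antiExp h0 t)
    · simp [antiExp, shiftedExp_neg_half, -one_div]
    · simp [antiExp, shiftedExp_half, -one_div]
  · simp only [if_neg hj]
    have h0 : h j = 0 := by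
      rw [← hu, mem_freqSupport] at hj
      exact not_not.1 hj
    have := hasTestApprox_false hsm hbd hj
    simpa only [h0, shiftedExp_zero] using this

/-- Reduces products of complex factors to products of real ones, against which the weak derivative
can be tested. -/
lemma prod_eq_sum_re_im (f : Fin s → ℂ) :
    ∏ j, f j = ∑ t ∈ (Finset.univ : Finset (Fin s)).powerset, Complex.I ^ (Finset.univ \ t).card *
      ((∏ j, (if j ∈ t then Complex.reCLM else Complex.imCLM) (f j) : ℝ) : ℂ) := by
  have h1 : ∏ j, f j = ∏ j, (((f j).re : ℂ) + (f j).im * Complex.I) :=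
    Finset.prod_congr rfl fun j _ => (Complex.re_add_im _).symm
  rw [h1, Finset.prod_add]
  refine Finset.sum_congr rfl fun t _ => ?_
  rw [Finset.prod_mul_distrib, Finset.prod_const, ← mul_assoc, mul_comm]
  congr 1
  push_cast
  rw [← Finset.prod_sdiff (Finset.subset_univ t), mul_comm]
  congr 1
  · refine Finset.prod_congr rfl fun j hj => ?_
    rw [if_neg (Finset.mem_sdiff.1 hj).2]; rfl
  · refine Finset.prod_congr rfl fun j hj => ?_
    rw [if_pos hj]; rfl

lemma integral_prod_mul_eq_sum {F : (Fin s → ℝ) → ℝ} (hF : Integrable F (cubeMeasure (Fin s)))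
    {α : Fin s → ℝ → ℂ} (hα : ∀ j, Continuous (α j)) :
    ∫ y, (∏ j, α j (y j)) * (F y : ℂ) ∂(cubeMeasure (Fin s)) =
      ∑ t ∈ (Finset.univ : Finset (Fin s)).powerset, Complex.I ^ (Finset.univ \ t).card *
        ((∫ y, F y * ∏ j, (if j ∈ t then Complex.reCLM else Complex.imCLM) (α j (y j))
          ∂(cubeMeasure (Fin s)) : ℝ) : ℂ) := by
  have hint : ∀ t : Finset (Fin s), Integrable (fun y : Fin s → ℝ =>
      F y * ∏ j, (if j ∈ t then Complex.reCLM else Complex.imCLM) (α j (y j)))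
      (cubeMeasure (Fin s)) := by
    intro t
    refine IntegrableOn.mul_continuousOn hF (Continuous.continuousOn ?_) isCompact_Icc
    exact continuous_finsetProd _ fun j _ =>
      (ContinuousLinearMap.continuous _).comp ((hα j).comp (continuous_apply j))
  simp_rw [← integral_complex_ofReal, ← integral_const_mul]
  rw [← integral_finsetSum _ fun t _ => (hint t).ofReal.const_mul _]
  refine integral_congr_ae (Filter.Eventually.of_forall fun y => ?_)
  simp only
  rw [prod_eq_sum_re_im, Finset.sum_mul]
  refine Finset.sum_congr rfl fun t _ => ?_
  simp only [Complex.ofReal_mul]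
  ring

lemma cubeFourierCoeff_eq {F g : (Fin s → ℝ) → ℝ} {h : Fin s → ℤ}
    (hF : Integrable F (cubeMeasure (Fin s))) (hg : IsWeakMixedDeriv F (freqSupport h) g) :
    cubeFourierCoeff F h = (-1) ^ (freqSupport h).card *
      ∫ y, (∏ j, if j ∈ freqSupport h then antiExp (h j) (y j) else 1) * (g y : ℂ)
        ∂(cubeMeasure (Fin s)) := by
  have hgint : Integrable g (cubeMeasure (Fin s)) := hg.1.integrable (by norm_num)
  rw [cubeFourierCoeff, integral_prod_mul_eq_sum hF fun j => continuous_shiftedExp (h j),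
    integral_prod_mul_eq_sum (α := fun j t => if j ∈ freqSupport h then antiExp (h j) t else 1)
      hgint, Finset.mul_sum]
  · refine Finset.sum_congr rfl fun t _ => ?_
    rw [integral_weakMixedDeriv_mul_prod hF hg
      (a := fun j x => (if j ∈ t then Complex.reCLM else Complex.imCLM) (shiftedExp (h j) x))
      (A := fun j x => (if j ∈ t then Complex.reCLM else Complex.imCLM)
        (if j ∈ freqSupport h then antiExp (h j) x else 1)) fun j => ?_]
    · push_cast; ring
    · refine hasTestApprox_shiftedExp rfl _ (fun z => ?_) j
      split_ifs
      · exact Complex.abs_re_le_norm z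
      · exact Complex.abs_im_le_norm z
  · intro j
    split_ifs
    · exact continuous_antiExp _
    · exact continuous_const

lemma measurePreserving_split (u : Finset (Fin s)) :
    MeasurePreserving (MeasurableEquiv.piEquivPiSubtypeProd (fun _ : Fin s => ℝ) (· ∈ u))
      (cubeMeasure (Fin s)) ((cubeMeasure {j // j ∈ u}).prod (cubeMeasure {j // j ∉ u})) := by
  rw [cubeMeasure_eq_pi, cubeMeasure_eq_pi, cubeMeasure_eq_pi]
  convert! measurePreserving_piEquivPiSubtypeProd
    (fun _ : Fin s => (volume : Measure ℝ).restrict (Set.Icc (-(1 / 2)) (1 / 2))) (· ∈ u)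

lemma split_symm_apply (u : Finset (Fin s)) (p : ({j // j ∈ u} → ℝ) × ({j // j ∉ u} → ℝ)) :
    (MeasurableEquiv.piEquivPiSubtypeProd (fun _ : Fin s => ℝ) (· ∈ u)).symm p =
      combine u p.1 p.2 := rfl

lemma integrable_combine {g : (Fin s → ℝ) → ℝ} (hg : Integrable g (cubeMeasure (Fin s)))
    (u : Finset (Fin s)) :
    Integrable (fun p : ({j // j ∈ u} → ℝ) × ({j // j ∉ u} → ℝ) => g (combine u p.1 p.2))
      ((cubeMeasure {j // j ∈ u}).prod (cubeMeasure {j // j ∉ u})) :=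
  (measurePreserving_split u).symm.integrable_comp_of_integrable hg

/-- The factors depend on `y_u` alone, so Fubini leaves the integral of `g` over the other
variables, exactly the inner integral of the unanchored norm. -/
lemma integral_prod_mul_eq_integral_combine {g : (Fin s → ℝ) → ℝ}
    (hg : Integrable g (cubeMeasure (Fin s))) (u : Finset (Fin s)) {α : Fin s → ℝ → ℂ}
    (hα : ∀ j, Continuous (α j)) :
    ∫ y, (∏ j, if j ∈ u then α j (y j) else 1) * (g y : ℂ) ∂(cubeMeasure (Fin s)) =
      ∫ yu, (∏ j : {j // j ∈ u}, α j (yu j)) *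
        ((∫ yc, g (combine u yu yc) ∂(cubeMeasure {j // j ∉ u}) : ℝ) : ℂ)
          ∂(cubeMeasure {j // j ∈ u}) := by
  set A : ({j // j ∈ u} → ℝ) → ℂ := fun yu => ∏ j : {j // j ∈ u}, α j (yu j) with hA
  have hAc : Continuous A := continuous_finsetProd _ fun j _ => (hα j).comp (continuous_apply j)
  have hprod : ∀ p : ({j // j ∈ u} → ℝ) × ({j // j ∉ u} → ℝ),
      (∏ j, if j ∈ u then α j (combine u p.1 p.2 j) else 1) = A p.1 := by
    intro p
    rw [Finset.prod_ite_mem, Finset.univ_inter, hA, ← Finset.prod_attach]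
    exact Finset.prod_congr rfl fun j _ => by simp [combine, j.2]
  have hint : Integrable (fun y => (∏ j, if j ∈ u then α j (y j) else 1) * (g y : ℂ))
      (cubeMeasure (Fin s)) := by
    refine IntegrableOn.continuousOn_mul (Continuous.continuousOn ?_) hg.ofReal isCompact_Icc
    refine continuous_finsetProd _ fun j _ => ?_
    split_ifs
    · exact (hα j).comp (continuous_apply j)
    · exact continuous_const
  have h1 := (measurePreserving_split u).symm
  have hint2 := h1.integrable_comp_of_integrable hint
  refine (h1.integral_comp'
    (g := fun y => (∏ j, if j ∈ u then α j (y j) else 1) * (g y : ℂ))).symm.trans ?_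
  refine (integral_prod _ hint2).trans ?_
  refine integral_congr_ae (Filter.Eventually.of_forall fun yu => ?_)
  simp only [Function.comp_apply, split_symm_apply]
  simp_rw [fun yc => hprod (yu, yc)]
  rw [integral_const_mul, integral_complex_ofReal]

/-- Here `|e - 1|² = 2 - 2 Re e` has mean 2, and the denominator is `4π²n²`. This produces the `2π²`
of the Korobov weights. -/
lemma integral_norm_antiExp_sq {n : ℤ} (hn : n ≠ 0) :
    ∫ t in Set.Icc (-(1 / 2) : ℝ) (1 / 2), ‖antiExp n t‖ ^ 2 = 1 / (2 * Real.pi ^ 2) / (n : ℝ) ^ 2 := by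
  have hn' : (n : ℝ) ≠ 0 := by exact_mod_cast hn
  have h1 : ∀ t, ‖antiExp n t‖ ^ 2 = (2 - 2 * (shiftedExp n t).re) / (4 * Real.pi ^ 2 * (n : ℝ) ^ 2) := by
    intro t
    have h2 : ‖shiftedExp n t - 1‖ ^ 2 = 2 - 2 * (shiftedExp n t).re := by
      have h3 := norm_shiftedExp n t
      have h4 : ‖shiftedExp n t‖ ^ 2 = 1 := by rw [h3]; norm_num
      rw [← Complex.normSq_eq_norm_sq, Complex.normSq_apply] at h4 ⊢
      simp only [Complex.sub_re, Complex.sub_im, Complex.one_re, Complex.one_im]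
      linarith
    rw [antiExp, norm_div, div_pow, h2]
    congr 1
    rw [norm_neg, norm_mul, norm_mul, norm_mul, Complex.norm_I, Complex.norm_real,
      Complex.norm_intCast, Complex.norm_two, mul_pow, mul_pow, mul_pow, Real.norm_eq_abs, sq_abs,
      sq_abs]
    ring
  have h3 : ∫ t in (-(1 / 2) : ℝ)..(1 / 2), (shiftedExp n t).re = 0 := by
    rw [intervalIntegral.integral_eq_sub_of_hasDerivAt (f := fun t => (antiExp n t).re)
      (f' := fun t => (shiftedExp n t).re)
      (fun t _ => Complex.reCLM.hasFDerivAt.comp_hasDerivAt t (hasDerivAt_antiExp hn t))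
      ((Complex.continuous_re.comp (continuous_shiftedExp n)).intervalIntegrable _ _)]
    simp only [antiExp, shiftedExp_half, shiftedExp_neg_half, sub_self]
  simp_rw [h1]
  rw [integral_Icc_eq_integral_Ioc, ← intervalIntegral.integral_of_le (by norm_num),
    intervalIntegral.integral_div, intervalIntegral.integral_sub, intervalIntegral.integral_const_mul,
    h3, intervalIntegral.integral_const]
  · have := Real.pi_ne_zero
    norm_num
    field_simp
    norm_num
  · exact intervalIntegrable_const
  · exact (continuous_const.mul
      (Complex.continuous_re.comp (continuous_shiftedExp n))).intervalIntegrable _ _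

lemma lintegral_prod_antiExp (h : Fin s → ℤ) :
    ∫⁻ yu, ‖∏ j : {j // j ∈ freqSupport h}, antiExp (h j) (yu j)‖ₑ ^ 2
      ∂(cubeMeasure {j // j ∈ freqSupport h}) =
      ∏ j ∈ freqSupport h, (ENNReal.ofReal (1 / (2 * Real.pi ^ 2)) * freqTerm 2 (h j)) := by
  have h1 : ∀ yu : {j // j ∈ freqSupport h} → ℝ,
      ‖∏ j : {j // j ∈ freqSupport h}, antiExp (h j) (yu j)‖ₑ ^ 2 =
      ENNReal.ofReal (∏ j : {j // j ∈ freqSupport h}, ‖antiExp (h j) (yu j)‖ ^ 2) := by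
    intro yu
    rw [Finset.prod_pow, ← norm_prod, ENNReal.ofReal_pow (norm_nonneg _), ofReal_norm]
  simp_rw [h1]
  rw [← ofReal_integral_eq_lintegral_ofReal, cubeMeasure_eq_pi,
    integral_fintype_prod_eq_prod (f := fun (j : {j // j ∈ freqSupport h}) t =>
      ‖antiExp (h j) t‖ ^ 2), ENNReal.ofReal_prod_of_nonneg, ← Finset.prod_attach (freqSupport h)]
  · refine Finset.prod_congr rfl fun j _ => ?_
    have hj : h j ≠ 0 := mem_freqSupport.1 j.2
    have hj' : 0 < |(h j : ℝ)| := abs_pos.2 (by exact_mod_cast hj)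
    rw [integral_norm_antiExp_sq hj, freqTerm, if_neg hj, div_eq_mul_inv,
      ENNReal.ofReal_mul (by positivity), ← ENNReal.ofReal_inv_of_pos (by positivity)]
    congr 3
    rw [← sq_abs]
    norm_cast
  · intro j _
    exact integral_nonneg fun t => by positivity
  · refine Continuous.integrableOn_Icc ?_
    exact continuous_finsetProd _ fun j _ =>
      (((continuous_antiExp _).comp (continuous_apply j)).norm.pow 2)
  · exact Filter.Eventually.of_forall fun yu => Finset.prod_nonneg fun j _ => by positivity

/-- Cauchy-Schwarz in the variables `y_u`, after integration by parts and Fubini. -/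
lemma enorm_cubeFourierCoeff_sq_le {F g : (Fin s → ℝ) → ℝ} {h : Fin s → ℤ}
    (hF : Integrable F (cubeMeasure (Fin s))) (hg : IsWeakMixedDeriv F (freqSupport h) g) :
    ‖cubeFourierCoeff F h‖ₑ ^ 2 ≤
      (∏ j ∈ freqSupport h, (ENNReal.ofReal (1 / (2 * Real.pi ^ 2)) * freqTerm 2 (h j))) *
        ∫⁻ yu, ‖∫ yc, g (combine (freqSupport h) yu yc) ∂(cubeMeasure {j // j ∉ freqSupport h})‖ₑ ^ 2
          ∂(cubeMeasure {j // j ∈ freqSupport h}) := by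
  have hgint : Integrable g (cubeMeasure (Fin s)) := hg.1.integrable (by norm_num)
  rw [cubeFourierCoeff_eq hF hg,
    integral_prod_mul_eq_integral_combine hgint _ fun j => continuous_antiExp (h j),
    ← lintegral_prod_antiExp]
  set A : ({j // j ∈ freqSupport h} → ℝ) → ℂ := fun yu =>
    ∏ j : {j // j ∈ freqSupport h}, antiExp (h j) (yu j)
  set D : ({j // j ∈ freqSupport h} → ℝ) → ℝ := fun yu =>
    ∫ yc, g (combine (freqSupport h) yu yc) ∂(cubeMeasure {j // j ∉ freqSupport h})
  have hAm : Continuous A := continuous_finsetProd _ fun j _ =>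
    (continuous_antiExp _).comp (continuous_apply j)
  have hDm : AEStronglyMeasurable D (cubeMeasure {j // j ∈ freqSupport h}) :=
    (integrable_combine hgint (freqSupport h)).integral_prod_left.aestronglyMeasurable
  have h1 : ‖(-1 : ℂ) ^ (freqSupport h).card *
      ∫ yu, A yu * (D yu : ℂ) ∂(cubeMeasure {j // j ∈ freqSupport h})‖ₑ ≤
      ∫⁻ yu, ‖A yu‖ₑ * ‖D yu‖ₑ ∂(cubeMeasure {j // j ∈ freqSupport h}) := by
    rw [enorm_mul, enorm_pow, enorm_neg, enorm_one, one_pow, one_mul]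
    refine (enorm_integral_le_lintegral_enorm _).trans (le_of_eq ?_)
    refine lintegral_congr fun yu => ?_
    rw [enorm_mul]
    congr 1
    rw [← ofReal_norm, ← ofReal_norm, Complex.norm_real]
  have h2 := ENNReal.lintegral_mul_le_Lp_mul_Lq (cubeMeasure {j // j ∈ freqSupport h})
    Real.HolderConjugate.two_two hAm.aestronglyMeasurable.enorm hDm.enorm
  simp only [Pi.mul_apply, ENNReal.rpow_two] at h2
  calc _ ≤ (∫⁻ yu, ‖A yu‖ₑ * ‖D yu‖ₑ ∂(cubeMeasure {j // j ∈ freqSupport h})) ^ 2 := by gcongr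
    _ ≤ _ := pow_le_pow_left' h2 2
    _ = _ := by
        rw [mul_pow, ← ENNReal.rpow_natCast, ← ENNReal.rpow_natCast, ← ENNReal.rpow_mul,
          ← ENNReal.rpow_mul, Nat.cast_ofNat, one_div, inv_mul_cancel₀ two_ne_zero,
          ENNReal.rpow_one, ENNReal.rpow_one]

/-! ### Existence of an outcome of the construction -/

lemma unitsMod_nonempty {n : ℕ} (hn : 0 < n) : (unitsMod n).Nonempty := by
  rcases Nat.lt_or_ge 1 n with h | h
  · exact ⟨1, by simp [unitsMod, h]⟩
  · obtain rfl : n = 1 := by omega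
    exact ⟨0, by simp [unitsMod]⟩

lemma prefixErrorSq_congr (α : ℝ) (γ : Finset (Fin s) → ℝ) (N b : ℕ) (w : Fin s → ℕ)
    {z z' : Fin s → ℕ} {j : Fin s} (h : ∀ i ≤ j, z i = z' i) :
    prefixErrorSq α γ N (genVector b w z) j = prefixErrorSq α γ N (genVector b w z') j := by
  unfold prefixErrorSq genVector
  congr 2
  funext i
  rw [h _ (Fin.le_def.2 (Nat.lt_succ_iff.1 i.isLt))]

/-- Greedy choice over finite nonempty sets. The error at `j` sees only the components up to `j`, so
later choices do not disturb earlier minimality. -/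
lemma exists_isOutcome {b : ℕ} (hb : 0 < b) (m : ℕ) (w : Fin s → ℕ) (α : ℝ)
    (γ : Finset (Fin s) → ℝ) : ∃ z, IsOutcome b m w α γ z := by
  have main : ∀ d ≤ s, ∃ z : Fin s → ℕ, ∀ j : Fin s, j.val < d → (m ≤ w j → z j = 0) ∧
      (w j < m → z j ∈ unitsMod (b ^ (m - w j)) ∧ ∀ x ∈ unitsMod (b ^ (m - w j)),
        prefixErrorSq α γ (b ^ m) (genVector b w z) j ≤
          prefixErrorSq α γ (b ^ m) (genVector b w (Function.update z j x)) j) := by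
    intro d
    induction d with
    | zero => exact fun _ => ⟨0, fun j hj => absurd hj (Nat.not_lt_zero _)⟩
    | succ d ih =>
      intro hd
      obtain ⟨z, hz⟩ := ih (by omega)
      set k : Fin s := ⟨d, hd⟩ with hk
      have hstep : ∀ x₀ : ℕ, (m ≤ w k → x₀ = 0) →
          (w k < m → x₀ ∈ unitsMod (b ^ (m - w k)) ∧ ∀ x ∈ unitsMod (b ^ (m - w k)),
            prefixErrorSq α γ (b ^ m) (genVector b w (Function.update z k x₀)) k ≤
              prefixErrorSq α γ (b ^ m) (genVector b w (Function.update z k x)) k) →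
          ∃ z : Fin s → ℕ, ∀ j : Fin s, j.val < d + 1 → (m ≤ w j → z j = 0) ∧
            (w j < m → z j ∈ unitsMod (b ^ (m - w j)) ∧ ∀ x ∈ unitsMod (b ^ (m - w j)),
              prefixErrorSq α γ (b ^ m) (genVector b w z) j ≤
                prefixErrorSq α γ (b ^ m) (genVector b w (Function.update z j x)) j) := by
        intro x₀ h0 h1
        refine ⟨Function.update z k x₀, fun j hj => ?_⟩
        rcases (Nat.lt_succ_iff.1 hj).eq_or_lt with hjd | hjd
        · obtain rfl : j = k := Fin.ext hjd
          simpa using ⟨h0, h1⟩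
        · have hne : ∀ i ≤ j, i ≠ k := by
            rintro i hi rfl
            exact absurd hjd (not_lt.2 hi)
          have hagree : ∀ x, ∀ i ≤ j, Function.update (Function.update z k x₀) j x i =
              Function.update z j x i := by
            intro x i hi
            rcases eq_or_ne i j with rfl | hij
            · simp
            · rw [Function.update_of_ne hij, Function.update_of_ne hij,
                Function.update_of_ne (hne i hi)]
          rw [Function.update_of_ne (hne j le_rfl)]
          refine ⟨(hz j hjd).1, fun hw => ⟨((hz j hjd).2 hw).1, fun x hx => ?_⟩⟩
          rw [prefixErrorSq_congr α γ (b ^ m) b w (z := Function.update z k x₀) (z' := z)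
              fun i hi => Function.update_of_ne (hne i hi) _ _,
            prefixErrorSq_congr α γ (b ^ m) b w (hagree x)]
          exact ((hz j hjd).2 hw).2 x hx
      rcases lt_or_ge (w k) m with hw | hw
      · obtain ⟨x₀, hx₀, hmin⟩ := Finset.exists_min_image (unitsMod (b ^ (m - w k)))
          (fun x => prefixErrorSq α γ (b ^ m) (genVector b w (Function.update z k x)) k)
          (unitsMod_nonempty (pow_pos hb _))
        exact hstep x₀ (fun h => absurd h (not_le.2 hw)) fun _ => ⟨hx₀, hmin⟩
      · exact hstep 0 (fun _ => rfl) fun h => absurd h (not_lt.2 hw)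
  obtain ⟨z, hz⟩ := main s le_rfl
  exact ⟨z, fun j => (hz j j.isLt).1, fun j hj => ((hz j j.isLt).2 hj).1,
    fun j hj => ((hz j j.isLt).2 hj).2⟩

/-! ### The error bound -/

lemma freqWeight_korobovWeights {γ : Finset (Fin s) → ℝ} (hγ : ∀ u, 0 ≤ γ u) (h : Fin s → ℤ) :
    freqWeight 2 (korobovWeights γ) h = ENNReal.ofReal (γ (freqSupport h)) *
      ∏ j ∈ freqSupport h, (ENNReal.ofReal (1 / (2 * Real.pi ^ 2)) * freqTerm 2 (h j)) := by
  have hpi := Real.pi_pos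
  rw [freqWeight, korobovWeights, Finset.prod_mul_distrib, Finset.prod_const, ← mul_assoc,
    ← ENNReal.ofReal_pow (by positivity), ← ENNReal.ofReal_mul (hγ _), one_div, inv_pow,
    ← div_eq_mul_inv]

/-- The mean square error is bounded by the squared worst-case error in the Korobov space times
the squared Sobolev norm. -/
lemma integral_sqError_le {γ : Finset (Fin s) → ℝ} (hγ : ∀ u, 0 ≤ γ u) {F : (Fin s → ℝ) → ℝ}
    (hF : MemSobolev γ F) {N : ℕ} (hN : 0 < N) (z : Fin s → ℕ) :
    ENNReal.ofReal (∫ Δ in Set.Icc (0 : Fin s → ℝ) 1, sqError N z F Δ) ≤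
      dualSum 2 (korobovWeights γ) N z {h | h ≠ 0} * sobolevNorm γ F ^ 2 := by
  obtain ⟨hF2, hweak, hfin⟩ := hF
  set J : Finset (Fin s) → ℝ≥0∞ := fun u =>
    ∫⁻ yu, ‖∫ yc, weakMixedDeriv F u (combine u yu yc) ∂(cubeMeasure {j // j ∉ u})‖ₑ ^ 2
      ∂(cubeMeasure {j // j ∈ u}) with hJ
  set T : ℝ≥0∞ := ∑ u : Finset (Fin s), (ENNReal.ofReal (γ u))⁻¹ * J u with hT
  have hnorm : sobolevNorm γ F = T ^ (1 / 2 : ℝ) := rfl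
  have hsq : sobolevNorm γ F ^ 2 = T := by
    rw [hnorm, ← ENNReal.rpow_natCast, ← ENNReal.rpow_mul]
    norm_num
  have hTtop : T ≠ ⊤ := by
    rw [← hsq]; exact ENNReal.pow_ne_top hfin.ne
  have hderiv : ∀ u, IsWeakMixedDeriv F u (weakMixedDeriv F u) := by
    intro u
    rw [weakMixedDeriv, dif_pos (hweak u)]
    exact (hweak u).choose_spec
  -- Each term of the norm is at most the whole sum. If `γ u = 0`, finiteness of the norm forces `J
  -- u = 0`.
  have hJle : ∀ u, J u ≤ ENNReal.ofReal (γ u) * T := by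
    intro u
    have h1 : (ENNReal.ofReal (γ u))⁻¹ * J u ≤ T :=
      Finset.single_le_sum (f := fun u => (ENNReal.ofReal (γ u))⁻¹ * J u)
        (fun _ _ => zero_le) (Finset.mem_univ u)
    exact (le_mul_inv_mul ENNReal.ofReal_ne_top (ne_top_of_le_ne_top hTtop h1)).trans (by gcongr)
  rw [(integral_sqError hF2 hN z).2, hsq, dualSum, ← ENNReal.tsum_mul_right]
  refine ENNReal.tsum_le_tsum fun h => ?_
  refine (enorm_cubeFourierCoeff_sq_le (hF2.integrable (by norm_num)) (hderiv _)).trans ?_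
  rw [freqWeight_korobovWeights hγ, mul_comm (ENNReal.ofReal _), mul_assoc]
  gcongr
  exact hJle _

/-- Each element of `u` contributes `(2π²)^(-λ)` from the Korobov weight and `2ζ(2λ)` from the
frequency sum; their product is `ϱ(λ)`. -/
lemma ofReal_korobovWeights_rpow_mul {γ : Finset (Fin s) → ℝ} (hγ : ∀ u, 0 ≤ γ u) {lam : ℝ}
    (hl : 1 / 2 < lam) (u : Finset (Fin s)) :
    ENNReal.ofReal (korobovWeights γ u) ^ lam * (∑' k, freqTerm (2 * lam) k) ^ u.card =
      ENNReal.ofReal (γ u ^ lam * rho lam ^ u.card) := by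
  have hpi := Real.pi_pos
  have hl0 : 0 < lam := by linarith
  have hz := riemannZeta_re_nonneg (β := 2 * lam) (by linarith)
  have hk : 0 ≤ korobovWeights γ u := div_nonneg (hγ u) (by positivity)
  rw [tsum_freqTerm_eq (by linarith), ENNReal.ofReal_rpow_of_nonneg hk hl0.le,
    ← ENNReal.ofReal_pow (by positivity), ← ENNReal.ofReal_mul (by positivity)]
  congr 1
  rw [korobovWeights, rho, Real.div_rpow (hγ u) (by positivity), mul_pow _ (_ ^ (-lam)),
    Real.rpow_neg (by positivity), inv_pow, ← Real.rpow_natCast (2 * Real.pi ^ 2),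
    ← Real.rpow_natCast ((2 * Real.pi ^ 2) ^ lam), ← Real.rpow_mul (by positivity),
    ← Real.rpow_mul (by positivity), mul_comm lam]
  field_simp

lemma rho_nonneg {lam : ℝ} (hl : 1 / 2 < lam) : 0 ≤ rho lam := by
  have hz := riemannZeta_re_nonneg (β := 2 * lam) (by linarith)
  rw [rho]; positivity

lemma dualSum_rpow_le_ofReal {b : ℕ} (hb : b.Prime) {m : ℕ} {w : Fin s → ℕ} (hw : Monotone w)
    {γ : Finset (Fin s) → ℝ} (hγ : ∀ u, 0 ≤ γ u) {z : Fin s → ℕ}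
    (hz : IsOutcome b m w 2 (korobovWeights γ) z) {lam : ℝ} (hl : 1 / 2 < lam) (hl1 : lam ≤ 1) :
    dualSum 2 (korobovWeights γ) (b ^ m) (genVector b w z) {h | h ≠ 0} ^ lam ≤
      ENNReal.ofReal ((∑ u : Finset (Fin s) with u.Nonempty,
        γ u ^ lam * rho lam ^ u.card * (b : ℝ) ^ min m (u.sup w)) * (2 / ((b ^ m : ℕ) : ℝ))) := by
  have hN : 0 < b ^ m := pow_pos hb.pos m
  have hrho := rho_nonneg hl
  have hterm : ∀ u, 0 ≤ γ u ^ lam * rho lam ^ u.card := fun u =>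
    mul_nonneg (Real.rpow_nonneg (hγ u) _) (pow_nonneg hrho _)
  refine (dualSum_rpow_le hb hw z (korobovWeights γ) one_lt_two (by linarith) hl1 (by linarith)
    fun d hd x hx => ?_).trans (le_of_eq ?_)
  · rw [← prefixErrorSq_eq one_lt_two _ hN, ← prefixErrorSq_eq one_lt_two _ hN]
    exact hz.minimal d hd x hx
  · rw [ENNReal.ofReal_mul (Finset.sum_nonneg fun u _ => mul_nonneg (hterm u) (by positivity)),
      ENNReal.ofReal_sum_of_nonneg fun u _ => mul_nonneg (hterm u) (by positivity)]
    congr 1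
    · refine Finset.sum_congr rfl fun u _ => ?_
      rw [ofReal_korobovWeights_rpow_mul hγ hl, ENNReal.ofReal_mul (hterm u),
        ENNReal.ofReal_pow (by positivity), ENNReal.ofReal_natCast]
    · rw [ENNReal.ofReal_div_of_pos (by exact_mod_cast hN), ENNReal.ofReal_natCast]
      push_cast
      simp

end ReducedCBC

end

theorem theorem3 (b : ℕ) (hb : b.Prime) (m s : ℕ) (w : Fin s → ℕ) (hw : Monotone w)
    (γ : Finset (Fin s) → ℝ) (hγ : ∀ u, 0 ≤ γ u) :
    (∃ z : Fin s → ℕ, ReducedCBC.IsOutcome b m w 2 (ReducedCBC.korobovWeights γ) z) ∧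
    ∀ z : Fin s → ℕ, ReducedCBC.IsOutcome b m w 2 (ReducedCBC.korobovWeights γ) z →
      ∀ F : (Fin s → ℝ) → ℝ, ReducedCBC.MemSobolev γ F →
        IntegrableOn (ReducedCBC.sqError (b ^ m) (ReducedCBC.genVector b w z) F)
          (Set.Icc (0 : Fin s → ℝ) 1) ∧
        ∀ lam : ℝ, 1 / 2 < lam → lam ≤ 1 →
          ReducedCBC.rmse (b ^ m) (ReducedCBC.genVector b w z) F ≤
            (∑ u : Finset (Fin s) with u.Nonempty,
              γ u ^ lam * ReducedCBC.rho lam ^ u.card * (b : ℝ) ^ min m (u.sup w)) ^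
                (1 / (2 * lam)) *
              (2 / ((b ^ m : ℕ) : ℝ)) ^ (1 / (2 * lam)) *
              (ReducedCBC.sobolevNorm γ F).toReal := by
  refine ⟨ReducedCBC.exists_isOutcome hb.pos m w _ _, fun z hz F hF => ?_⟩
  have hN : 0 < b ^ m := pow_pos hb.pos m
  refine ⟨(ReducedCBC.integral_sqError hF.1 hN _).1, fun lam hl hl1 => ?_⟩
  have hl0 : 0 < lam := by linarith
  have hX : 0 ≤ ∑ u : Finset (Fin s) with u.Nonempty,
      γ u ^ lam * ReducedCBC.rho lam ^ u.card * (b : ℝ) ^ min m (u.sup w) :=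
    Finset.sum_nonneg fun u _ => mul_nonneg (mul_nonneg (Real.rpow_nonneg (hγ u) _)
      (pow_nonneg (ReducedCBC.rho_nonneg hl) _)) (by positivity)
  rw [← Real.mul_rpow hX (by positivity)]
  have hbound := ReducedCBC.dualSum_rpow_le_ofReal hb hw hγ hz hl hl1
  have herr := ReducedCBC.integral_sqError_le hγ hF hN (ReducedCBC.genVector b w z)
  set X := (∑ u : Finset (Fin s) with u.Nonempty,
      γ u ^ lam * ReducedCBC.rho lam ^ u.card * (b : ℝ) ^ min m (u.sup w)) *
        (2 / ((b ^ m : ℕ) : ℝ))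
  set S := ReducedCBC.dualSum 2 (ReducedCBC.korobovWeights γ) (b ^ m)
    (ReducedCBC.genVector b w z) {h | h ≠ 0}
  have hX0 : 0 ≤ X := mul_nonneg hX (by positivity)
  have hE : 0 ≤ ∫ Δ in Set.Icc (0 : Fin s → ℝ) 1,
      ReducedCBC.sqError (b ^ m) (ReducedCBC.genVector b w z) F Δ :=
    integral_nonneg fun Δ => by unfold ReducedCBC.sqError; positivity
  -- The bound controls `S ^ λ`; the exponent `1 / (2λ)` turns it into one for `√S`.
  have hS : S ^ (1 / 2 : ℝ) ≤ ENNReal.ofReal (X ^ (1 / (2 * lam))) := by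
    calc S ^ (1 / 2 : ℝ) = (S ^ lam) ^ (1 / (2 * lam)) := by
          rw [← ENNReal.rpow_mul]; congr 1; field_simp
      _ ≤ ENNReal.ofReal X ^ (1 / (2 * lam)) := ENNReal.rpow_le_rpow hbound (by positivity)
      _ = _ := ENNReal.ofReal_rpow_of_nonneg hX0 (by positivity)
  rw [ReducedCBC.rmse, ← ENNReal.ofReal_le_ofReal_iff (by positivity),
    ENNReal.ofReal_mul (by positivity), ENNReal.ofReal_toReal hF.2.2.ne, Real.sqrt_eq_rpow,
    ← ENNReal.ofReal_rpow_of_nonneg hE (by norm_num)]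
  calc _ ≤ (S * ReducedCBC.sobolevNorm γ F ^ 2) ^ (1 / 2 : ℝ) :=
        ENNReal.rpow_le_rpow herr (by norm_num)
    _ = S ^ (1 / 2 : ℝ) * ReducedCBC.sobolevNorm γ F := by
        rw [ENNReal.mul_rpow_of_nonneg _ _ (by norm_num), ← ENNReal.rpow_natCast,
          ← ENNReal.rpow_mul]
        norm_num
    _ ≤ _ := by gcongr
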